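/- **Setting.** Let $(K,v)$ be a (commutative) valued field with value group $\Gamma=v(K^\times)$, and let $\sigma$ be an endomorphism of $K$ such that for all $a\in K^\times$: $v(a)\ge 0$ implies $v(\sigma(a))\ge v(a)$, and $v(a)>0$ implies $v(\sigma(a))>v(a)$. Let $\sigma_v$ be the induced endomorphism of $\Gamma$, $\sigma_v(v(a))=v(\sigma(a))$, and assume that $\sigma_v(\gamma)\ge\gamma+\gamma$ for all $\gamma\ge 0$. Assume that $Fix(\sigma)=\{a\in K:\sigma(a)=a\}$ is finite and that $K$ has a finite basis $(1=c_0,\dots,c_{n-1})$ as a vector space over $\sigma(K)$. Let $A=K[t;\sigma]$ be the skew polynomial ring with $a\,t=t\,\sigma(a)$; its elements are written $q=\sum_i t^i a_i$. Call $q$ $\sigma$-separable if $a_0\neq 0$, and let $\mathcal I$ be the set of those $q$ with $v(a_i)\ge 0$ for all $i$ and $v(a_i)=0$ for some $i$. Let $(\Delta,\le,0_\Delta,\tau,+\gamma;\gamma\in\Gamma)$ be a totally ordered set with a distinguished element $0_\Delta$, a transitive action of $\Gamma$ such that $\delta_1\le\delta_2\Rightarrow\delta_1+\gamma\le\delta_2+\gamma$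 and $\gamma_1<\gamma_2\Rightarrow \delta+\gamma_1<\delta+\gamma_2$, and a strictly increasing surjective map $\tau:\Delta\to\Delta$ with $\tau(0_\Delta)=0_\Delta$, $\tau(\delta)>\delta$ for $\delta>0_\Delta$, $\tau(\delta)<\delta$ for $\delta<0_\Delta$, and $\tau(\delta+\gamma)=\tau(\delta)+\sigma_v(\gamma)$. The language $\mathcal L_V$ is that of right $A$-modules together with unary functions $\lambda_i$ ($i<n$) and unary predicates $V_\delta$ ($\delta\in\Delta$). A *model of $T_V^{sep}\cup T_{tor}$* is an $\mathcal L_V$-structure $M$ such that: 1. $M$ is a right $A$-module and each $x\in M$ can be written in exactly one way as $x=\sum_{i<n}x_i\cdot tc_i$ with $x_i\in M$, and then $\lambda_i(x)=x_i$; 2. the predicates come from a valuation: there is a surjective map $w:M\to\Delta\cup\{\infty\}$ with $V_\delta=\{m: w(m)\ge\delta\}$ for all $\delta$, $w(m)=\infty$ iff $m=0$, $w(m_1+m_2)\ge\min\{w(m_1),w(m_2)\}$, $w(m\cdot\mu)=w(m)+v(\mu)$ for $m\ne0$, $\mu\in K^\times$, and $w(m\cdot t)=\tau(w(m))$ (with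 $\tau(\infty)=\infty$); 3. for every $\sigma$-separable $q\in\mathcal I$ and every $x\in V_{0_\Delta}$ there is $m\in V_{0_\Delta}$ with $m\cdot q=x$; 4. for every $\sigma$-separable $q\in\mathcal I$ of degree $d$, the maximal number of elements of $\{m\in M: m\cdot q=0\}$ that are linearly independent over $Fix(\sigma)$ is exactly $d$. A *submodel* of $M$ is an $\mathcal L_V$-substructure of $M$ that is itself a model of $T_V^{sep}\cup T_{tor}$. **Corollary 7.5.** Let $M$ and $N$ be models of $T_V^{sep}\cup T_{tor}$. (a) Let $M_0\subseteq M$ and $N_0\subseteq N$ be $\mathcal L_V$-substructures and let $f:M_0\to N_0$ be an isomorphism of $\mathcal L_V$-structures. Then there is a smallest (in particular, minimal) submodel $M_0^{sep}$ of $M$ containing $M_0$ and a smallest submodel $N_0^{sep}$ of $N$ containing $N_0$, and $f$ extends to an isomorphism of $\mathcal L_V$-structures $M_0^{sep}\to N_0^{sep}$. (b) Consequently the torsion part is determined up to isomorphism: the sets $M_{tor}$ and $N_{tor}$ of torsion elements (those $m$ with $m\cdot r=0$ for some nonzero $r\in A$) are $\mathcal L_V$-substructures of $M$ and $N$, and they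 are isomorphic as $\mathcal L_V$-structures. -/

import Mathlib

/-!
# Valued modules over skew polynomial rings

`K` is a field with an endomorphism `σ`.  Following Mathlib, `σ` is given by an action of
`Multiplicative ℕ` on `K`: every endomorphism arises in this way, from its iterates.

`SkewPolynomial K` has the commutation rule `X * a = σ a * X`.  It is the opposite of the ring
`A = K[t; σ]` with the rule `a t = t σ(a)`: the element `∑ tⁱ aᵢ` of `A` corresponds to `∑ aᵢ Xⁱ`.
A right `A`-module is the same as a left `SkewPolynomial K`-module, and `m · q` is written `q • m`.
In particular `m · (t a)` is `SkewPolynomial.monomial 1 a • m`.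
-/

namespace OreModule

open SkewPolynomial

section ValuedField

/-- The distinguished endomorphism `σ` of `K`. -/
abbrev sig (K : Type*) [Field K] [MulSemiringAction (Multiplicative ℕ) K] : K →+* K :=
  SkewPolynomial.φ

/-- A (Krull) valuation `v` on the field `K` with value group exactly `Γ`, written additively, such
that `σ` is increasing on the valuation ring and strictly increasing on the nonzero elements of
the maximal ideal. -/
structure ContractiveValuation (K Γ : Type*) [Field K] [MulSemiringAction (Multiplicative ℕ) K]
    [AddCommGroup Γ] [LinearOrder Γ] [IsOrderedAddMonoid Γ] where
  v : AddValuation K (WithTop Γ)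
  surj : ∀ γ : Γ, ∃ a : K, v a = (γ : WithTop Γ)
  le_sig : ∀ a : K, 0 ≤ v a → v a ≤ v (sig K a)
  lt_sig : ∀ a : K, a ≠ 0 → 0 < v a → v a < v (sig K a)

namespace ContractiveValuation

variable {K Γ : Type*} [Field K] [MulSemiringAction (Multiplicative ℕ) K]
  [AddCommGroup Γ] [LinearOrder Γ] [IsOrderedAddMonoid Γ] (𝓥 : ContractiveValuation K Γ)

theorem v_unit_ne_top (a : Kˣ) : 𝓥.v (a : K) ≠ ⊤ := fun h =>
  a.ne_zero ((AddValuation.top_iff 𝓥.v).1 h)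

/-- The valuation as a map `Kˣ → Γ`. -/
def val (a : Kˣ) : Γ := (𝓥.v (a : K)).untop (𝓥.v_unit_ne_top a)

theorem coe_val (a : Kˣ) : ((𝓥.val a : Γ) : WithTop Γ) = 𝓥.v (a : K) :=
  WithTop.coe_untop _ _

theorem val_mul (a b : Kˣ) : 𝓥.val (a * b) = 𝓥.val a + 𝓥.val b := by
  have h : ((𝓥.val (a * b) : Γ) : WithTop Γ) = ((𝓥.val a + 𝓥.val b : Γ) : WithTop Γ) := by
    rw [WithTop.coe_add, coe_val, coe_val, coe_val, Units.val_mul, AddValuation.map_mul]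
  exact_mod_cast h

theorem val_surjective : Function.Surjective 𝓥.val := by
  intro γ
  obtain ⟨a, ha⟩ := 𝓥.surj γ
  have h0 : a ≠ 0 := by
    rintro rfl
    rw [AddValuation.map_zero] at ha
    exact WithTop.top_ne_coe ha
  refine ⟨Units.mk0 a h0, ?_⟩
  have h : ((𝓥.val (Units.mk0 a h0) : Γ) : WithTop Γ) = (γ : WithTop Γ) := by
    rw [coe_val]; exact ha
  exact_mod_cast h

/-- `σ` on the multiplicative group of `K`. -/
abbrev sigU (K : Type*) [Field K] [MulSemiringAction (Multiplicative ℕ) K] : Kˣ →* Kˣ :=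
  Units.map (sig K : K →* K)

/-- The map `σ_v` induced by `σ` on `Γ`, determined by `σ_v (v a) = v (σ a)`,
see `sigv_val` below. -/
noncomputable def sigv (γ : Γ) : Γ := 𝓥.val (sigU K (Function.surjInv 𝓥.val_surjective γ))

theorem sigv_val (a : Kˣ) : 𝓥.sigv (𝓥.val a) = 𝓥.val (sigU K a) := by
  have key : ∀ b : Kˣ, 𝓥.val b = 0 → 0 ≤ 𝓥.val (sigU K b) := by
    intro b hb
    have h1 : 𝓥.v (b : K) = 0 := by rw [← coe_val, hb]; rfl
    have h2 := 𝓥.le_sig (b : K) h1.ge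
    rw [h1] at h2
    have h3 : ((0 : Γ) : WithTop Γ) ≤ ((𝓥.val (sigU K b) : Γ) : WithTop Γ) := by
      rw [coe_val]; exact h2
    exact_mod_cast h3
  have one : 𝓥.val 1 = 0 := by
    have := 𝓥.val_mul 1 1
    rw [one_mul] at this
    exact left_eq_add.mp this
  have mono : ∀ a b : Kˣ, 𝓥.val a = 𝓥.val b → 𝓥.val (sigU K b) ≤ 𝓥.val (sigU K a) := by
    intro a b hab
    have e : a * b⁻¹ * b = a := by group
    have h0 : 𝓥.val (a * b⁻¹) = 0 := by
      have := 𝓥.val_mul (a * b⁻¹) b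
      rw [e, hab] at this
      exact right_eq_add.mp this
    have h1 := 𝓥.val_mul (sigU K (a * b⁻¹)) (sigU K b)
    rw [← map_mul, e] at h1
    rw [h1]
    exact le_add_of_nonneg_left (key _ h0)
  have hs : 𝓥.val (Function.surjInv 𝓥.val_surjective (𝓥.val a)) = 𝓥.val a :=
    Function.surjInv_eq _ _
  exact le_antisymm (mono _ _ hs.symm) (mono _ _ hs)

/-- `σ_v` is 2-contracting: `σ_v γ ≥ γ + γ` for all `γ ≥ 0`. -/
def TwoContracting : Prop := ∀ γ : Γ, 0 ≤ γ → γ + γ ≤ 𝓥.sigv γ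

/-- The set `𝓘` of the skew polynomials with coefficients in the valuation ring, at least one of
which has valuation `0`. -/
def scrI : Set (SkewPolynomial K) :=
  {q | (∀ i, 0 ≤ 𝓥.v (q.coeff i)) ∧ ∃ i, 𝓥.v (q.coeff i) = 0}

end ContractiveValuation

/-- `q` is `σ`-separable: its constant coefficient `q(0)` is nonzero. -/
def IsSep {K : Type*} [Field K] (q : SkewPolynomial K) : Prop := q.coeff 0 ≠ 0

/-- `q` is nonzero of degree `d`. -/
def HasDegree {K : Type*} [Field K] (q : SkewPolynomial K) (d : ℕ) : Prop :=
  q.coeff d ≠ 0 ∧ ∀ j, d < j → q.coeff j = 0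

end ValuedField

section Chain

variable {K Γ : Type*} [Field K] [MulSemiringAction (Multiplicative ℕ) K]
  [AddCommGroup Γ] [LinearOrder Γ] [IsOrderedAddMonoid Γ]

/-- The structure `(Δ, ≤, 0_Δ, τ, +γ ; γ ∈ Γ)`; the chain `Δ` is given with its linear order and
its `Γ`-action, and `δ + γ` is written `γ +ᵥ δ`. -/
structure Chain (𝓥 : ContractiveValuation K Γ) (Δ : Type*) [LinearOrder Δ] [AddAction Γ Δ] where
  zero : Δ
  τ : Δ → Δ
  vadd_le : ∀ (γ : Γ) (δ₁ δ₂ : Δ), δ₁ ≤ δ₂ → γ +ᵥ δ₁ ≤ γ +ᵥ δ₂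
  vadd_lt : ∀ (γ₁ γ₂ : Γ) (δ : Δ), γ₁ < γ₂ → γ₁ +ᵥ δ < γ₂ +ᵥ δ
  transitive : ∀ δ₁ δ₂ : Δ, ∃ γ : Γ, γ +ᵥ δ₁ = δ₂
  τ_lt : ∀ δ₁ δ₂ : Δ, δ₁ < δ₂ → τ δ₁ < τ δ₂
  τ_zero : τ zero = zero
  lt_τ : ∀ δ : Δ, zero < δ → δ < τ δ
  τ_lt_self : ∀ δ : Δ, δ < zero → τ δ < δ
  τ_vadd : ∀ (γ : Γ) (δ : Δ), τ (γ +ᵥ δ) = 𝓥.sigv γ +ᵥ τ δ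

end Chain

section Structures

/-- The symbols of the language `𝓛_V` on top of those of modules: unary functions `λ_i`, `i < n`,
and unary predicates `V_δ`, `δ ∈ Δ`. -/
structure LV (n : ℕ) (Δ M : Type*) where
  lam : Fin n → M → M
  V : Δ → Set M

variable {K : Type*} [Field K] [MulSemiringAction (Multiplicative ℕ) K] {n : ℕ} {Δ : Type*}

/-- An `𝓛_V`-substructure: a submodule closed under the functions `λ_i`. -/
structure LVSub (K : Type*) [Field K] [MulSemiringAction (Multiplicative ℕ) K] {n : ℕ}
    {Δ M : Type*} [AddCommGroup M] [Module (SkewPolynomial K) M] (S : LV n Δ M) where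
  toSubmodule : Submodule (SkewPolynomial K) M
  lam_mem : ∀ (i : Fin n) (x : M), x ∈ toSubmodule → S.lam i x ∈ toSubmodule

/-- The induced symbols on a substructure. -/
def LVSub.induced {M : Type*} [AddCommGroup M] [Module (SkewPolynomial K) M] {S : LV n Δ M}
    (P : LVSub K S) : LV n Δ P.toSubmodule where
  lam i x := ⟨S.lam i x, P.lam_mem i x x.2⟩
  V δ := {x | (x : M) ∈ S.V δ}

/-- An isomorphism of `𝓛_V`-structures. -/
structure LVIso (K : Type*) [Field K] [MulSemiringAction (Multiplicative ℕ) K] {n : ℕ}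
    {Δ M N : Type*} [AddCommGroup M] [Module (SkewPolynomial K) M] [AddCommGroup N]
    [Module (SkewPolynomial K) N] (S : LV n Δ M) (S' : LV n Δ N) where
  toEquiv : M ≃ₗ[SkewPolynomial K] N
  map_lam : ∀ (i : Fin n) (x : M), toEquiv (S.lam i x) = S'.lam i (toEquiv x)
  mem_V : ∀ (δ : Δ) (x : M), x ∈ S.V δ ↔ toEquiv x ∈ S'.V δ

/-- The set of torsion elements of a module. -/
def torsionSet (K M : Type*) [Field K] [MulSemiringAction (Multiplicative ℕ) K]
    [AddCommGroup M] [Module (SkewPolynomial K) M] : Set M :=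
  {m | ∃ r : SkewPolynomial K, r ≠ 0 ∧ r • m = 0}

end Structures

section Theories

variable {K Γ : Type*} [Field K] [MulSemiringAction (Multiplicative ℕ) K]
  [AddCommGroup Γ] [LinearOrder Γ] [IsOrderedAddMonoid Γ] {𝓥 : ContractiveValuation K Γ}
  {Δ : Type*} [LinearOrder Δ] [AddAction Γ Δ]
  {M : Type*} [AddCommGroup M] [Module (SkewPolynomial K) M] {n : ℕ}

/-- `w : M → Δ ∪ {∞}` makes `M` a valued `A`-module, is surjective, and `t` acts on the values
through `τ`. -/
structure IsModuleValuation (D : Chain 𝓥 Δ) (w : M → WithTop Δ) : Prop where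
  min_le : ∀ m₁ m₂ : M, min (w m₁) (w m₂) ≤ w (m₁ + m₂)
  eq_top : ∀ m : M, w m = ⊤ ↔ m = 0
  lt_iff : ∀ m₁ m₂ : M, w m₁ < w m₂ ↔
    w ((X : SkewPolynomial K) • m₁) < w ((X : SkewPolynomial K) • m₂)
  smul : ∀ (m : M) (μ : Kˣ), m ≠ 0 →
    w ((C (μ : K) : SkewPolynomial K) • m) = (w m).map (fun δ => 𝓥.val μ +ᵥ δ)
  surjective : Function.Surjective w
  map_t : ∀ m : M, w ((X : SkewPolynomial K) • m) = (w m).map D.τ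

/-- The theory `T_σ`, for the `σ`-basis `c`: the functions `λ_i` give the components in the
decomposition `M = ⨁ M · t c_i`. -/
structure ModelsTσ (c : Fin n → K) (S : LV n Δ M) : Prop where
  eq_sum : ∀ x : M, x = ∑ i, (monomial 1 (c i) : SkewPolynomial K) • S.lam i x
  unique : ∀ (x : M) (y : Fin n → M),
    x = ∑ i, (monomial 1 (c i) : SkewPolynomial K) • y i → ∀ i, y i = S.lam i x

/-- The theory `T_V`. -/
structure ModelsTV (D : Chain 𝓥 Δ) (c : Fin n → K) (S : LV n Δ M) : Prop where
  tσ : ModelsTσ c S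
  anti : ∀ (δ₁ δ₂ : Δ) (m : M), δ₁ ≤ δ₂ → m ∈ S.V δ₂ → m ∈ S.V δ₁
  add : ∀ (δ : Δ) (m₁ m₂ : M), m₁ ∈ S.V δ → m₂ ∈ S.V δ → m₁ + m₂ ∈ S.V δ
  smul : ∀ (δ : Δ) (m : M) (μ : Kˣ), m ∈ S.V δ →
    (C (μ : K) : SkewPolynomial K) • m ∈ S.V (𝓥.val μ +ᵥ δ)
  t_iff : ∀ (δ : Δ) (m : M), m ∈ S.V δ ↔ (X : SkewPolynomial K) • m ∈ S.V (D.τ δ)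

/-- The scheme of divisibility axioms: `V_0` is divisible by every `σ`-separable `q ∈ 𝓘`. -/
def ModelsDiv (D : Chain 𝓥 Δ) (S : LV n Δ M) : Prop :=
  ∀ q : SkewPolynomial K, q ∈ 𝓥.scrI → IsSep q →
    ∀ x ∈ S.V D.zero, ∃ m ∈ S.V D.zero, q • m = x

/-- Linear independence of a finite family over the fixed field of `σ`. -/
def FixIndep (K : Type*) [Field K] [MulSemiringAction (Multiplicative ℕ) K] {M : Type*}
    [AddCommGroup M] [Module (SkewPolynomial K) M] {d : ℕ} (x : Fin d → M) : Prop :=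
  ∀ a : Fin d → K, (∀ i, sig K (a i) = a i) →
    ∑ i, (C (a i) : SkewPolynomial K) • x i = 0 → ∀ i, a i = 0

/-- The theory `T_tor`: for every `σ`-separable `q ∈ 𝓘` of degree `d`, the maximal number of
elements of the annihilator of `q` that are linearly independent over `Fix σ` is exactly `d`. -/
def ModelsTtor (𝓥 : ContractiveValuation K Γ) (M : Type*) [AddCommGroup M]
    [Module (SkewPolynomial K) M] : Prop :=
  ∀ (q : SkewPolynomial K) (d : ℕ), q ∈ 𝓥.scrI → IsSep q → HasDegree q d →
    (∃ x : Fin d → M, (∀ i, q • x i = 0) ∧ FixIndep K x) ∧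
    ¬ ∃ x : Fin (d + 1) → M, (∀ i, q • x i = 0) ∧ FixIndep K x

/-- The `𝓛_V`-structures `(M, (λ_i), (M_δ))` associated with a valued `A`-module `(M, Δ, w)`, where
`M_δ = {m : w m ≥ δ}`, that are models of `T_V^sep ∪ T_tor`. -/
structure IsModel (D : Chain 𝓥 Δ) (c : Fin n → K) (S : LV n Δ M) : Prop where
  valued : ∃ w : M → WithTop Δ, IsModuleValuation D w ∧
    ∀ δ, S.V δ = {m | (δ : WithTop Δ) ≤ w m}
  tV : ModelsTV D c S
  div : ModelsDiv D S
  tor : ModelsTtor 𝓥 M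

/-- `P` is the smallest submodel containing `M₀`: it is a submodel containing `M₀`, and every
submodel containing `M₀` contains `P`. In particular no proper substructure of `P` containing `M₀`
is a model. -/
def IsMinimalSubmodel (D : Chain 𝓥 Δ) (c : Fin n → K) {S : LV n Δ M} (M₀ P : LVSub K S) : Prop :=
  (M₀.toSubmodule ≤ P.toSubmodule ∧ IsModel D c P.induced) ∧
    ∀ Q : LVSub K S, M₀.toSubmodule ≤ Q.toSubmodule → IsModel D c Q.induced →
      P.toSubmodule ≤ Q.toSubmodule

end Theories

end OreModule

namespace OreModule

open SkewPolynomial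

set_option linter.unusedSectionVars false

/-! ### Skew polynomials: coefficients, degree and right division -/

section Polynomials

variable {K : Type*} [Field K] [MulSemiringAction (Multiplicative ℕ) K]

/-! The map `γ ↦ γ +ᵥ 0_Δ` identifies `Γ` with `Δ` and turns `τ` into `σ_v`, so a model becomes a
module with values in `Γ ∪ {∞}` (`IsHenselian`) and `σ` is surjective on values. Rescaling by
constants carries the axioms for `𝓘` to every level, so each σ-separable `q` acts surjectively on
the module, and its annihilator has `|Fix σ| ^ deg q` elements. Hence a submodel contains all
solutions of separable equations with right-hand side in it: it has one solution, and its
annihilator of `q` is already the whole one. Conversely, a substructure closed under such solutions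
is a model. The smallest submodel is therefore the separable closure `sepClosure`, and the closure
of zero is the torsion part.

For the isomorphism, `f` is viewed as its graph, a value-preserving linear relation, and Zorn's
lemma reduces the claim to a one-step extension (`IsPartialIsometry.exists_extension`). Take `q` of
minimal degree with a solution `m` outside the domain. One needs a solution `n` of the corresponding
equation in `N`, outside the range, with `u (m + x) = u' (n + y)` for all `(x, y)` in the graph.
Finiteness of solution sets gives an `n` at least as close to the range as `m` is to the domain. It
can be kept outside the range because the annihilator of `q` has equally many elements in each ball
of `M` and of `N` (`card_annihilator_ball`). Going back to `M` and starting from an `m` whose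
distances are maximal gives equality. Minimality of the degree then carries it from `m + x` to all
`p • m + x` (`le_sep_smul_add`, `le_smul_add`).

The ball count compares `q` with its truncation at the last unit coefficient: all solutions for the
truncation are integral, and the solutions of either equation are approximated by integral solutions
of the other (`card_integral_annihilator`). -/

theorem skew_ext {p q : SkewPolynomial K} (h : ∀ i, p.coeff i = q.coeff i) : p = q :=
  SkewMonoidAlgebra.ext fun a => h (Multiplicative.toAdd a)

@[simp] theorem skew_coeff_add (p q : SkewPolynomial K) (i : ℕ) :
    (p + q).coeff i = p.coeff i + q.coeff i := by
  simp [SkewPolynomial.coeff]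

@[simp] theorem skew_coeff_sub (p q : SkewPolynomial K) (i : ℕ) :
    (p - q).coeff i = p.coeff i - q.coeff i := by
  simp [SkewPolynomial.coeff]

/-- The coefficient map as an additive homomorphism. -/
def coeffHom (K : Type*) [Field K] [MulSemiringAction (Multiplicative ℕ) K] (i : ℕ) :
    SkewPolynomial K →+ K where
  toFun p := p.coeff i
  map_zero' := SkewPolynomial.coeff_zero i
  map_add' p q := skew_coeff_add p q i

@[simp] theorem skew_coeff_sum {ι : Type*} (s : Finset ι) (f : ι → SkewPolynomial K) (i : ℕ) :
    (∑ j ∈ s, f j).coeff i = ∑ j ∈ s, (f j).coeff i :=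
  map_sum (coeffHom K i) f s

theorem exists_coeff_bound (p : SkewPolynomial K) : ∃ N, ∀ i, N ≤ i → p.coeff i = 0 := by
  refine ⟨p.support.sup id + 1, fun i hi => ?_⟩
  by_contra h
  have := Finset.le_sup (f := id) (mem_support_iff.2 h)
  simp only [id] at this
  omega

theorem eq_sum_monomial {p : SkewPolynomial K} {N : ℕ} (h : ∀ i, N ≤ i → p.coeff i = 0) :
    p = ∑ i ∈ Finset.range N, monomial i (p.coeff i) := by
  refine skew_ext fun j => ?_
  simp only [skew_coeff_sum, coeff_monomial, Finset.sum_ite_eq', Finset.mem_range]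
  split_ifs with hj
  · rfl
  · exact h j (not_lt.1 hj)

theorem skew_induction {P : SkewPolynomial K → Prop} (hadd : ∀ p q, P p → P q → P (p + q))
    (hm : ∀ i a, P (monomial i a)) (p : SkewPolynomial K) : P p := by
  refine SkewPolynomial.induction p ?_ fun n r q _ _ hq => hadd _ _ (hm n r) hq
  simpa using hm 0 0

@[simp] theorem skew_coeff_C_mul (a : K) (p : SkewPolynomial K) (i : ℕ) :
    (C a * p).coeff i = a * p.coeff i := by
  refine skew_induction (P := fun p => (C a * p).coeff i = a * p.coeff i) ?_ ?_ p
  · intro p q hp hq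
    rw [mul_add, skew_coeff_add, hp, hq, skew_coeff_add, mul_add]
  · intro j b
    rw [C_mul_monomial, coeff_monomial, coeff_monomial]
    split_ifs <;> simp

@[simp] theorem skew_coeff_mul_C (a : K) (p : SkewPolynomial K) (i : ℕ) :
    (p * C a).coeff i = p.coeff i * (sig K)^[i] a := by
  refine skew_induction (P := fun p => (p * C a).coeff i = p.coeff i * (sig K)^[i] a) ?_ ?_ p
  · intro p q hp hq
    rw [add_mul, skew_coeff_add, hp, hq, skew_coeff_add, add_mul]
  · intro j b
    rw [monomial_mul_C, coeff_monomial, coeff_monomial]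
    split_ifs with h
    · rw [h]
    · simp

theorem coeff_monomial_mul (a : K) (j : ℕ) (p : SkewPolynomial K) (i : ℕ) :
    (monomial j a * p).coeff (j + i) = a * (sig K)^[j] (p.coeff i) := by
  refine skew_induction
    (P := fun p => (monomial j a * p).coeff (j + i) = a * (sig K)^[j] (p.coeff i)) ?_ ?_ p
  · intro p q hp hq
    rw [mul_add, skew_coeff_add, hp, hq, skew_coeff_add, iterate_map_add, mul_add]
  · intro k b
    rw [monomial_mul_monomial, coeff_monomial, coeff_monomial]
    by_cases h : k = i
    · subst h; simp
    · rw [if_neg h, if_neg (by omega)]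
      simp

theorem coeff_monomial_mul_of_lt (a : K) {j i : ℕ} (p : SkewPolynomial K) (h : i < j) :
    (monomial j a * p).coeff i = 0 := by
  refine skew_induction (P := fun p => (monomial j a * p).coeff i = 0) ?_ ?_ p
  · intro p q hp hq
    rw [mul_add, skew_coeff_add, hp, hq, add_zero]
  · intro k b
    rw [monomial_mul_monomial, coeff_monomial, if_neg (by omega)]

theorem coeff_zero_mul (p q : SkewPolynomial K) : (p * q).coeff 0 = p.coeff 0 * q.coeff 0 := by
  refine skew_induction (P := fun p => (p * q).coeff 0 = p.coeff 0 * q.coeff 0) ?_ ?_ p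
  · intro p q hp hq
    rw [add_mul, skew_coeff_add, hp, hq, skew_coeff_add, add_mul]
  · intro j b
    cases j with
    | zero => simp
    | succ j => rw [coeff_monomial_mul_of_lt _ _ (Nat.succ_pos j)]; simp

/-- Every nonzero skew polynomial has a degree. -/
theorem exists_hasDegree {p : SkewPolynomial K} (hp : p ≠ 0) : ∃ d, HasDegree p d := by
  classical
  have hex : ∃ N, ∀ i, N ≤ i → p.coeff i = 0 := exists_coeff_bound p
  have h0 : Nat.find hex ≠ 0 := by
    intro h
    refine hp (skew_ext fun i => ?_)
    rw [Nat.find_spec hex i (by omega), SkewPolynomial.coeff_zero]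
  obtain ⟨d, hd⟩ := Nat.exists_eq_succ_of_ne_zero h0
  refine ⟨d, fun hc => Nat.find_min hex (m := d) (by omega) fun i hi => ?_, fun j hj =>
    Nat.find_spec hex j (by omega)⟩
  rcases hi.eq_or_lt with rfl | hlt
  · exact hc
  · exact Nat.find_spec hex i (by omega)

/-- Division with remainder on the right. -/
theorem exists_eq_mul_add {p : SkewPolynomial K} {d : ℕ} (hp : HasDegree p d)
    (f : SkewPolynomial K) : ∃ s r : SkewPolynomial K, f = s * p + r ∧
      ∀ j, d ≤ j → r.coeff j = 0 := by
  obtain ⟨N, hN⟩ := exists_coeff_bound f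
  induction N generalizing f with
  | zero => exact ⟨0, f, by simp, fun j _ => hN j (Nat.zero_le j)⟩
  | succ N ih =>
    rcases lt_or_ge N d with hlt | hge
    · exact ⟨0, f, by simp, fun j hj => hN j (by omega)⟩
    · obtain ⟨k, rfl⟩ := Nat.exists_eq_add_of_le' hge
      have hne : (sig K)^[k] (p.coeff d) ≠ 0 := by
        intro h
        rw [← iterate_map_zero (sig K) k] at h
        exact hp.1 ((Function.Injective.iterate (sig K).injective k) h)
      set m : SkewPolynomial K := monomial k (f.coeff (k + d) / (sig K)^[k] (p.coeff d)) with hm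
      obtain ⟨s, r, h1, h2⟩ := ih (f - m * p) (by
        intro i hi
        obtain ⟨l, rfl⟩ := Nat.exists_eq_add_of_le (show k ≤ i by omega)
        rw [skew_coeff_sub, hm, coeff_monomial_mul]
        rcases (show d ≤ l by omega).eq_or_lt with rfl | hlt
        · rw [div_mul_cancel₀ _ hne, sub_self]
        · rw [hN _ (by omega), hp.2 l hlt, iterate_map_zero, mul_zero, sub_zero])
      refine ⟨s + m, r, ?_, h2⟩
      rw [add_mul, add_right_comm, ← h1, sub_add_cancel]

theorem IsSep.ne_zero {q : SkewPolynomial K} (hq : IsSep q) : q ≠ 0 := by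
  rintro rfl
  exact hq (SkewPolynomial.coeff_zero 0)

/-- A nonzero skew polynomial is a `σ`-separable one times a power of `X`. -/
theorem exists_eq_sep_mul_X_pow {p : SkewPolynomial K} (hp : p ≠ 0) :
    ∃ (q : SkewPolynomial K) (k : ℕ), IsSep q ∧ p = q * X ^ k := by
  obtain ⟨N, hN⟩ := exists_coeff_bound p
  induction N generalizing p with
  | zero => exact absurd (skew_ext fun i => hN i (Nat.zero_le i)) hp
  | succ N ih =>
    by_cases h0 : p.coeff 0 = 0
    · set r : SkewPolynomial K := ∑ i ∈ Finset.range N, monomial i (p.coeff (i + 1)) with hr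
      have hpr : p = r * X := by
        conv_lhs => rw [eq_sum_monomial hN, Finset.sum_range_succ', h0]
        simp [hr, Finset.sum_mul]
      have hr0 : r ≠ 0 := by
        intro h
        rw [h, zero_mul] at hpr
        exact hp hpr
      obtain ⟨q, k, hq, h⟩ := ih hr0 (by
        intro i hi
        simp only [hr, skew_coeff_sum, coeff_monomial, Finset.sum_ite_eq', Finset.mem_range]
        rw [if_neg (by omega)])
      exact ⟨q, k + 1, hq, by rw [hpr, h, mul_assoc, ← pow_succ]⟩
    · exact ⟨p, 0, h0, by simp⟩

/-- If `k` is the lowest index in the support of `p`, the product has `k`-th coefficient `p_k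
σ^k(q_0)`, which is nonzero as `σ` is injective. -/
theorem mul_sep_ne_zero {p q : SkewPolynomial K} (hp : p ≠ 0) (hq : IsSep q) : p * q ≠ 0 := by
  intro h
  obtain ⟨N, hN⟩ := exists_coeff_bound p
  classical
  have hex : ∃ i, p.coeff i ≠ 0 := by
    by_contra hc
    push Not at hc
    exact hp (skew_ext fun i => by rw [hc, SkewPolynomial.coeff_zero])
  set k := Nat.find hex with hk
  have hmin : ∀ i < k, p.coeff i = 0 := fun i hi => not_not.1 (Nat.find_min hex hi)
  have hc : (p * q).coeff k = p.coeff k * (sig K)^[k] (q.coeff 0) := by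
    conv_lhs => rw [eq_sum_monomial hN, Finset.sum_mul, skew_coeff_sum]
    rw [Finset.sum_eq_single k]
    · simpa using coeff_monomial_mul (p.coeff k) k q 0
    · intro b _ hb
      rcases lt_or_gt_of_ne hb with hlt | hgt
      · simp [hmin b hlt]
      · exact coeff_monomial_mul_of_lt _ _ hgt
    · intro hn
      rw [Finset.mem_range, not_lt] at hn
      simp [hN k hn]
  rw [h, SkewPolynomial.coeff_zero] at hc
  refine mul_ne_zero (Nat.find_spec hex) ?_ hc.symm
  intro hz
  rw [← iterate_map_zero (sig K) k] at hz
  exact hq ((Function.Injective.iterate (sig K).injective k) hz)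

end Polynomials

/-! ### Annihilators as vector spaces over the fixed field -/

section FixedField

variable {K M : Type*} [Field K] [MulSemiringAction (Multiplicative ℕ) K]
  [AddCommGroup M] [Module (SkewPolynomial K) M]

theorem mul_C_of_fixed {a : K} (ha : sig K a = a) (q : SkewPolynomial K) :
    q * C a = C a * q := by
  refine skew_ext fun i => ?_
  rw [skew_coeff_mul_C, skew_coeff_C_mul, Function.iterate_fixed ha, mul_comm]

/-- The annihilator of `q` in `M` has `|Fix σ| ^ d` elements if the maximal number of its
elements that are linearly independent over `Fix σ` is `d`. -/
theorem card_annihilator_of_fixIndep (h_fix : {a : K | sig K a = a}.Finite)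
    {q : SkewPolynomial K} {d : ℕ}
    (h1 : ∃ x : Fin d → M, (∀ i, q • x i = 0) ∧ FixIndep K x)
    (h2 : ¬ ∃ x : Fin (d + 1) → M, (∀ i, q • x i = 0) ∧ FixIndep K x) :
    {m : M | q • m = 0}.Finite ∧
      {m : M | q • m = 0}.ncard = {a : K | sig K a = a}.ncard ^ d := by
  classical
  let F : Subfield K := RingHom.eqLocusField (sig K) (RingHom.id K)
  have hF : ∀ a : F, sig K a = a := fun a => a.2
  let _ : Module F M := Module.compHom M ((CRingHom (R := K)).comp F.subtype)
  have hsm : ∀ (a : F) (m : M), a • m = (C (a : K) : SkewPolynomial K) • m := fun _ _ => rfl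
  -- Fixed constants commute with `q`, so the annihilator is an `F`-subspace; `h1` and `h2` pin its
  -- dimension to `d`.
  let W : Submodule F M :=
    { carrier := {m | q • m = 0}
      add_mem' := fun {a b} ha hb => by
        simp only [Set.mem_ofPred_eq] at ha hb ⊢
        rw [smul_add, ha, hb, add_zero]
      zero_mem' := smul_zero _
      smul_mem' := fun a m hm => by
        simp only [Set.mem_ofPred_eq] at hm ⊢
        rw [hsm, smul_smul, mul_C_of_fixed (hF a), mul_smul, hm, smul_zero] }
  have hind : ∀ {e : ℕ} (x : Fin e → W),
      LinearIndependent F x ↔ FixIndep K (fun i => (x i : M)) := by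
    intro e x
    rw [← LinearMap.linearIndependent_iff W.subtype (Submodule.ker_subtype W),
      Fintype.linearIndependent_iff]
    constructor
    · intro h a ha hs i
      have := h (fun i => (⟨a i, ha i⟩ : F)) (by simpa [hsm] using hs) i
      exact congrArg Subtype.val this
    · intro h g hs i
      have := h (fun i => (g i : K)) (fun i => hF (g i)) (by simpa [hsm] using hs) i
      exact Subtype.ext this
  have hle : Module.rank F W ≤ d := by
    refine rank_le fun s hs => ?_
    by_contra hlt
    push Not at hlt
    obtain ⟨t, hts, htc⟩ := Finset.exists_subset_card_eq (show d + 1 ≤ s.card by omega)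
    have ht : LinearIndependent F (fun i : t => (i : W)) :=
      hs.comp (fun i : t => (⟨i, hts i.2⟩ : s)) fun a b hab =>
        Subtype.ext (congrArg (fun z : s => (z : W)) hab)
    have ht' : LinearIndependent F (fun i : Fin (d + 1) => ((t.equivFinOfCardEq htc).symm i : W)) :=
      ht.comp _ (t.equivFinOfCardEq htc).symm.injective
    exact h2 ⟨_, fun i => ((t.equivFinOfCardEq htc).symm i : W).2, (hind _).1 ht'⟩
  have hfin : Module.Finite F W :=
    Module.rank_lt_aleph0_iff.1 (hle.trans_lt (Cardinal.natCast_lt_aleph0))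
  obtain ⟨x, hx, hxi⟩ := h1
  have hge : d ≤ Module.finrank F W := by
    have := ((hind (fun i => (⟨x i, hx i⟩ : W))).2 hxi).fintype_card_le_finrank
    simpa using this
  have hrk : Module.finrank F W = d :=
    le_antisymm (Module.finrank_le_of_rank_le hle) hge
  have : Finite F := h_fix.to_subtype
  have : Finite W := Module.finite_of_finite F
  refine ⟨(inferInstance : Finite W), ?_⟩
  have := Module.natCard_eq_pow_finrank (K := F) (V := W)
  rw [hrk] at this
  exact this

end FixedField

/-! ### Counting by approximation in valued groups -/

section Filtration

variable {M Γ : Type*} [AddCommGroup M] [LinearOrder Γ]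

/-- Two finite subgroups of a valued abelian group: if each nonzero element of the first is
strictly approximated by an element of the second, then the first is not larger. -/
theorem card_le_of_approx {u : M → WithTop Γ}
    (hmin : ∀ x y, min (u x) (u y) ≤ u (x + y)) (hneg : ∀ x, u (-x) = u x)
    (htop : ∀ x, u x = ⊤ ↔ x = 0)
    (G H : AddSubgroup M) [Finite G] [Finite H]
    (happ : ∀ g ∈ G, g ≠ 0 → ∃ h ∈ H, u g < u (g - h)) : Nat.card G ≤ Nat.card H := by
  induction hn : Nat.card G using Nat.strong_induction_on generalizing G H with
  | _ n ih =>
  subst hn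
  by_cases hG : G = ⊥
  · subst hG
    rw [AddSubgroup.card_bot]
    exact Nat.card_pos
  obtain ⟨⟨g0, hg0⟩, hg0'⟩ := AddSubgroup.ne_bot_iff_exists_ne_zero.1 hG
  have hg00 : g0 ≠ 0 := fun h => hg0' (Subtype.ext h)
  obtain ⟨g1, ⟨hg1, hg10⟩, hg1min⟩ := Set.exists_min_image {g | g ∈ G ∧ g ≠ 0} u
    ((Set.toFinite (G : Set M)).subset fun g hg => hg.1) ⟨g0, hg0, hg00⟩
  have hg1t : u g1 ≠ ⊤ := fun h => hg10 ((htop _).1 h)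
  -- `g1` has the least value in `G`, and `B` is the open ball of that radius. The order of each of
  -- `G`, `H` splits into its part in `B`, treated by induction since `g1 ∉ B`, and its image modulo
  -- `B`.
  let B : AddSubgroup M :=
    { carrier := {x | u g1 < u x}
      add_mem' := fun {a b} ha hb => (lt_min ha hb).trans_le (hmin a b)
      zero_mem' := by
        change u g1 < u 0
        rw [(htop 0).2 rfl]
        exact lt_top_iff_ne_top.2 hg1t
      neg_mem' := fun {a} ha => by
        change u g1 < u (-a)
        rw [hneg]; exact ha }
  have hcard : ∀ L : AddSubgroup M,
      Nat.card L = Nat.card (B ⊓ L : AddSubgroup M) * B.relIndex L := by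
    intro L
    have := AddSubgroup.relIndex_mul_relIndex ⊥ (B ⊓ L) L bot_le inf_le_right
    rw [AddSubgroup.relIndex_bot_left, AddSubgroup.relIndex_bot_left,
      AddSubgroup.inf_relIndex_right] at this
    exact this.symm
  have hf1 : Finite (B ⊓ G : AddSubgroup M) :=
    (Set.toFinite (G : Set M)).subset (show ((B ⊓ G : AddSubgroup M) : Set M) ⊆ G from
      fun x hx => hx.2)
  have hf2 : Finite (B ⊓ H : AddSubgroup M) :=
    (Set.toFinite (H : Set M)).subset (show ((B ⊓ H : AddSubgroup M) : Set M) ⊆ H from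
      fun x hx => hx.2)
  have hlt : Nat.card (B ⊓ G : AddSubgroup M) < Nat.card G := by
    have : ((B ⊓ G : AddSubgroup M) : Set M).ncard < (G : Set M).ncard := by
      refine Set.ncard_lt_ncard ⟨fun x hx => hx.2, fun h => ?_⟩ (Set.toFinite _)
      exact lt_irrefl (u g1) (h hg1).1
    exact this
  have h1 := ih _ hlt (B ⊓ G) (B ⊓ H) (by
    rintro g ⟨hgB, hgG⟩ hg
    obtain ⟨h, hh, hgh⟩ := happ g hgG hg
    refine ⟨h, ⟨?_, hh⟩, hgh⟩
    change u g1 < u h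
    have h2 := hmin g (-(g - h))
    rw [hneg, show g + -(g - h) = h by abel] at h2
    exact (lt_min hgB (lt_trans hgB hgh)).trans_le h2) rfl
  -- Modulo `B` an element of `G` equals its approximation, so the image of `G` lies in that of `H`.
  have h2 : B.relIndex G ≤ B.relIndex H := by
    have hmap : ∀ L : AddSubgroup M, B.relIndex L = Nat.card (L.map (QuotientAddGroup.mk' B)) := by
      intro L
      rw [← AddSubgroup.relIndex_ker, QuotientAddGroup.ker_mk']
    rw [hmap, hmap]
    have : Finite (H.map (QuotientAddGroup.mk' B)) :=
      (Set.toFinite (H : Set M)).image (QuotientAddGroup.mk' B)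
    refine AddSubgroup.card_le_of_le ?_
    rintro _ ⟨g, hg, rfl⟩
    by_cases hg0 : g = 0
    · subst hg0
      rw [map_zero]; exact zero_mem _
    obtain ⟨h, hh, hgh⟩ := happ g hg hg0
    refine ⟨h, hh, ?_⟩
    rw [QuotientAddGroup.mk'_apply, QuotientAddGroup.mk'_apply, QuotientAddGroup.eq]
    change u g1 < u (-h + g)
    rw [neg_add_eq_sub]
    exact (hg1min g ⟨hg, hg0⟩).trans_lt hgh
  rw [hcard G, hcard H]
  exact Nat.mul_le_mul h1 h2

end Filtration

/-! ### Values of iterates of `σ`, and levels of a skew polynomial -/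

namespace ContractiveValuation

variable {K Γ : Type*} [Field K] [MulSemiringAction (Multiplicative ℕ) K]
  [AddCommGroup Γ] [LinearOrder Γ] [IsOrderedAddMonoid Γ] (𝓥 : ContractiveValuation K Γ)

theorem v_ne_top {a : K} (ha : a ≠ 0) : 𝓥.v a ≠ ⊤ := fun h =>
  ha ((AddValuation.top_iff 𝓥.v).1 h)

theorem exists_v_eq (γ : WithTop Γ) : ∃ a : K, 𝓥.v a = γ := by
  induction γ using WithTop.recTopCoe with
  | top => exact ⟨0, AddValuation.map_zero _⟩
  | coe γ => exact 𝓥.surj γ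

theorem ne_zero_of_v_ne_top {a : K} (h : 𝓥.v a ≠ ⊤) : a ≠ 0 := fun h0 =>
  h ((AddValuation.top_iff 𝓥.v).2 h0)

theorem v_mul_le_v_mul {a b : K} (c : K) (h : 𝓥.v a ≤ 𝓥.v b) : 𝓥.v (c * a) ≤ 𝓥.v (c * b) := by
  rw [AddValuation.map_mul, AddValuation.map_mul]
  exact add_le_add_right h _

theorem v_mul_le_v_mul_iff {a b c : K} (hc : c ≠ 0) :
    𝓥.v (c * a) ≤ 𝓥.v (c * b) ↔ 𝓥.v a ≤ 𝓥.v b := by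
  refine ⟨fun h => ?_, 𝓥.v_mul_le_v_mul c⟩
  simpa [inv_mul_cancel_left₀ hc] using 𝓥.v_mul_le_v_mul c⁻¹ h

theorem v_mul_lt_v_mul_iff {a b c : K} (hc : c ≠ 0) :
    𝓥.v (c * a) < 𝓥.v (c * b) ↔ 𝓥.v a < 𝓥.v b := by
  rw [← not_le, ← not_le, 𝓥.v_mul_le_v_mul_iff hc]

theorem v_one : 𝓥.v (1 : K) = 0 := AddValuation.map_one _

theorem v_sig_mono {a b : K} (h : 𝓥.v a ≤ 𝓥.v b) : 𝓥.v (sig K a) ≤ 𝓥.v (sig K b) := by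
  by_cases ha : a = 0
  · subst ha
    have hb : b = 0 := by
      rw [AddValuation.map_zero, top_le_iff] at h
      exact (AddValuation.top_iff 𝓥.v).1 h
    rw [hb]
  have hσ : sig K a ≠ 0 := (map_ne_zero (sig K)).2 ha
  have h1 : 0 ≤ 𝓥.v (a⁻¹ * b) := by
    rw [← 𝓥.v_one, ← 𝓥.v_mul_le_v_mul_iff ha, mul_one, mul_inv_cancel_left₀ ha]
    exact h
  have h2 := h1.trans (𝓥.le_sig _ h1)
  rw [← 𝓥.v_one, ← 𝓥.v_mul_le_v_mul_iff hσ, mul_one, ← map_mul, mul_inv_cancel_left₀ ha] at h2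
  exact h2

theorem v_iterate_mono {a b : K} (h : 𝓥.v a ≤ 𝓥.v b) (k : ℕ) :
    𝓥.v ((sig K)^[k] a) ≤ 𝓥.v ((sig K)^[k] b) := by
  induction k with
  | zero => exact h
  | succ k ih =>
    rw [Function.iterate_succ_apply', Function.iterate_succ_apply']
    exact 𝓥.v_sig_mono ih

theorem monotone_v_iterate {a : K} (h : 0 ≤ 𝓥.v a) : Monotone fun k => 𝓥.v ((sig K)^[k] a) := by
  have h0 : ∀ k, 0 ≤ 𝓥.v ((sig K)^[k] a) := by
    intro k
    induction k with
    | zero => exact h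
    | succ k ih =>
      rw [Function.iterate_succ_apply']
      exact ih.trans (𝓥.le_sig _ ih)
  refine monotone_nat_of_le_succ fun k => ?_
  rw [Function.iterate_succ_apply']
  exact 𝓥.le_sig _ (h0 k)

/-- The inverse of an element of negative value lies in the maximal ideal, where `σ` strictly raises
values. -/
theorem strictAnti_v_iterate {a : K} (h : 𝓥.v a < 0) :
    StrictAnti fun k => 𝓥.v ((sig K)^[k] a) := by
  have step : ∀ b : K, 𝓥.v b < 0 → 𝓥.v (sig K b) < 𝓥.v b := by
    intro b hb
    have hb0 : b ≠ 0 := 𝓥.ne_zero_of_v_ne_top (hb.trans_le le_top).ne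
    have hσ : sig K b ≠ 0 := (map_ne_zero (sig K)).2 hb0
    have h1 : 0 < 𝓥.v b⁻¹ := by
      rw [← 𝓥.v_one, ← 𝓥.v_mul_lt_v_mul_iff hb0, mul_one, mul_inv_cancel₀ hb0, 𝓥.v_one]
      exact hb
    have h2 := 𝓥.lt_sig _ (inv_ne_zero hb0) h1
    rw [← 𝓥.v_mul_lt_v_mul_iff (mul_ne_zero hσ hb0), mul_assoc, mul_inv_cancel₀ hb0, mul_one,
      mul_right_comm, ← map_mul, mul_inv_cancel₀ hb0, map_one, one_mul] at h2
    exact h2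
  have h0 : ∀ k, 𝓥.v ((sig K)^[k] a) < 0 := by
    intro k
    induction k with
    | zero => exact h
    | succ k ih =>
      rw [Function.iterate_succ_apply']
      exact (step _ ih).trans ih
  refine strictAnti_nat_of_succ_lt fun k => ?_
  rw [Function.iterate_succ_apply']
  exact step _ (h0 k)

/-- `v ν` is the least valuation of the coefficients of `q * C μ`. -/
def Level (q : SkewPolynomial K) (μ ν : K) : Prop :=
  (∀ i, 𝓥.v ν ≤ 𝓥.v (q.coeff i * (sig K)^[i] μ)) ∧ ∃ i, 𝓥.v (q.coeff i * (sig K)^[i] μ) = 𝓥.v ν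

/-- The coefficients become `ν⁻¹ q_i σ^i(μ)`. This normalisation transports the axioms about `𝓘` and
the unit ball to balls of any radius. -/
theorem Level.mem_scrI {q : SkewPolynomial K} {μ ν : K} (h : 𝓥.Level q μ ν) (hν : ν ≠ 0) :
    C ν⁻¹ * q * C μ ∈ 𝓥.scrI := by
  have hc : ∀ i, (C ν⁻¹ * q * C μ).coeff i = ν⁻¹ * (q.coeff i * (sig K)^[i] μ) := by
    intro i
    rw [skew_coeff_mul_C, skew_coeff_C_mul, mul_assoc]
  refine ⟨fun i => ?_, ?_⟩
  · rw [hc, ← 𝓥.v_one, ← inv_mul_cancel₀ hν]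
    exact 𝓥.v_mul_le_v_mul _ (h.1 i)
  · obtain ⟨i, hi⟩ := h.2
    refine ⟨i, ?_⟩
    rw [hc, ← 𝓥.v_one, ← inv_mul_cancel₀ hν, AddValuation.map_mul, hi, AddValuation.map_mul]

theorem exists_level {q : SkewPolynomial K} (hq : q ≠ 0) {μ : K} (hμ : μ ≠ 0) :
    ∃ ν, ν ≠ 0 ∧ 𝓥.Level q μ ν := by
  obtain ⟨i, hi, hmin⟩ := q.support.exists_min_image
    (fun i => 𝓥.v (q.coeff i * (sig K)^[i] μ))
    (Finset.nonempty_iff_ne_empty.2 fun h => hq (SkewPolynomial.support_eq_empty.1 h))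
  refine ⟨q.coeff i * (sig K)^[i] μ, mul_ne_zero (mem_support_iff.1 hi) ?_, fun j => ?_, i, rfl⟩
  · intro h
    rw [← iterate_map_zero (sig K) i] at h
    exact hμ ((Function.Injective.iterate (sig K).injective i) h)
  · by_cases hj : j ∈ q.support
    · exact hmin j hj
    · rw [SkewPolynomial.notMem_support_iff.1 hj, zero_mul, AddValuation.map_zero]
      exact le_top

/-- For each `i` in the support there is `a_i` with `q_i σ^i(a_i)` of value `v ν`. The `a_i` of
largest value serves as `μ`: its own term has value `v ν`, and the others have at least that. -/
theorem exists_level_of_surj (hσ : ∀ b : K, b ≠ 0 → ∃ a, 𝓥.v (sig K a) = 𝓥.v b)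
    {q : SkewPolynomial K} (hq : q ≠ 0) {ν : K} (hν : ν ≠ 0) : ∃ μ, μ ≠ 0 ∧ 𝓥.Level q μ ν := by
  have hk : ∀ (k : ℕ) (b : K), b ≠ 0 → ∃ a, 𝓥.v ((sig K)^[k] a) = 𝓥.v b := by
    intro k
    induction k with
    | zero => exact fun b _ => ⟨b, rfl⟩
    | succ k ih =>
      intro b hb
      obtain ⟨a, ha⟩ := hσ b hb
      have ha0 : a ≠ 0 := by
        rintro rfl
        rw [map_zero, AddValuation.map_zero] at ha
        exact 𝓥.v_ne_top hb ha.symm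
      obtain ⟨a', ha'⟩ := ih a ha0
      refine ⟨a', ?_⟩
      rw [Function.iterate_succ_apply', ← ha]
      exact le_antisymm (𝓥.v_sig_mono ha'.le) (𝓥.v_sig_mono ha'.ge)
  have hex : ∀ i, ∃ a, i ∈ q.support → 𝓥.v (q.coeff i * (sig K)^[i] a) = 𝓥.v ν := by
    intro i
    by_cases hi : i ∈ q.support
    · have hqi := mem_support_iff.1 hi
      obtain ⟨a, ha⟩ := hk i ((q.coeff i)⁻¹ * ν) (mul_ne_zero (inv_ne_zero hqi) hν)
      refine ⟨a, fun _ => ?_⟩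
      rw [AddValuation.map_mul, ha, ← AddValuation.map_mul, mul_inv_cancel_left₀ hqi]
    · exact ⟨0, fun h => absurd h hi⟩
  choose a ha using hex
  obtain ⟨i, hi, hmax⟩ := q.support.exists_max_image (fun i => 𝓥.v (a i))
    (Finset.nonempty_iff_ne_empty.2 fun h => hq (SkewPolynomial.support_eq_empty.1 h))
  refine ⟨a i, ?_, fun j => ?_, i, ha i hi⟩
  · intro h0
    have := ha i hi
    rw [h0, iterate_map_zero, mul_zero, AddValuation.map_zero] at this
    exact 𝓥.v_ne_top hν this.symm
  · by_cases hj : j ∈ q.support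
    · rw [← ha j hj]
      exact 𝓥.v_mul_le_v_mul _ (𝓥.v_iterate_mono (hmax j hj) j)
    · rw [SkewPolynomial.notMem_support_iff.1 hj, zero_mul, AddValuation.map_zero]
      exact le_top

theorem Level.le_of_le {q : SkewPolynomial K} {μ ν μ' ν' : K} (h : 𝓥.Level q μ ν)
    (h' : 𝓥.Level q μ' ν') (hle : 𝓥.v μ ≤ 𝓥.v μ') : 𝓥.v ν ≤ 𝓥.v ν' := by
  obtain ⟨i, hi⟩ := h'.2
  rw [← hi]
  exact (h.1 i).trans (𝓥.v_mul_le_v_mul _ (𝓥.v_iterate_mono hle i))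

end ContractiveValuation

/-! ### Solving separable equations in a valued module, and counting solutions in balls -/

section ValuedModule

variable {K Γ : Type*} [Field K] [MulSemiringAction (Multiplicative ℕ) K]
  [AddCommGroup Γ] [LinearOrder Γ] [IsOrderedAddMonoid Γ] {𝓥 : ContractiveValuation K Γ}
  {M N : Type*} [AddCommGroup M] [Module (SkewPolynomial K) M]
  [AddCommGroup N] [Module (SkewPolynomial K) N]

/-- A valued module over the skew polynomial ring, with values in the value group of `K`, that
satisfies the divisibility axioms and the axioms on annihilators. -/
structure IsHenselian (𝓥 : ContractiveValuation K Γ) (u : M → WithTop Γ) : Prop where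
  min_le : ∀ x y, min (u x) (u y) ≤ u (x + y)
  eq_top : ∀ x, u x = ⊤ ↔ x = 0
  smul : ∀ (a : K) x, u ((C a : SkewPolynomial K) • x) = 𝓥.v a + u x
  X_smul : ∀ (a : K) x, u x = 𝓥.v a → u ((X : SkewPolynomial K) • x) = 𝓥.v (sig K a)
  div : ∀ q ∈ 𝓥.scrI, IsSep q → ∀ x, 0 ≤ u x → ∃ y, 0 ≤ u y ∧ q • y = x
  tor : ModelsTtor 𝓥 M

namespace IsHenselian

variable {u : M → WithTop Γ} {u' : N → WithTop Γ}

theorem map_neg (hM : IsHenselian 𝓥 u) (x : M) : u (-x) = u x := by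
  have h1 : (C (-1 : K) : SkewPolynomial K) = -1 := by rw [_root_.map_neg, C_1]
  have h2 := hM.smul (-1) x
  rwa [h1, neg_one_smul, AddValuation.map_neg, AddValuation.map_one, zero_add] at h2

theorem le_sub (hM : IsHenselian 𝓥 u) {x y : M} {c : WithTop Γ} (hx : c ≤ u x) (hy : c ≤ u y) :
    c ≤ u (x - y) := by
  rw [sub_eq_add_neg]
  exact (le_min hx (hy.trans_eq (hM.map_neg y).symm)).trans (hM.min_le _ _)

theorem le_add (hM : IsHenselian 𝓥 u) {x y : M} {c : WithTop Γ} (hx : c ≤ u x) (hy : c ≤ u y) :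
    c ≤ u (x + y) := (le_min hx hy).trans (hM.min_le _ _)

theorem map_zero (hM : IsHenselian 𝓥 u) : u 0 = ⊤ := (hM.eq_top 0).2 rfl

theorem le_sum (hM : IsHenselian 𝓥 u) {ι : Type*} (s : Finset ι) (f : ι → M) {c : WithTop Γ}
    (h : ∀ i ∈ s, c ≤ u (f i)) : c ≤ u (∑ i ∈ s, f i) := by
  refine Finset.sum_induction f (fun x => c ≤ u x) (fun x y hx hy => hM.le_add hx hy) ?_ h
  rw [hM.map_zero]
  exact le_top

theorem lt_sum (hM : IsHenselian 𝓥 u) {ι : Type*} (s : Finset ι) (f : ι → M) {c : WithTop Γ}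
    (hc : c ≠ ⊤) (h : ∀ i ∈ s, c < u (f i)) : c < u (∑ i ∈ s, f i) := by
  refine Finset.sum_induction f (fun x => c < u x)
    (fun x y hx hy => (lt_min hx hy).trans_le (hM.min_le x y)) ?_ h
  rw [hM.map_zero]
  exact lt_top_iff_ne_top.2 hc

theorem monomial_smul (hM : IsHenselian 𝓥 u) {x : M} {μ : K} (h : u x = 𝓥.v μ) (i : ℕ) (a : K) :
    u ((monomial i a : SkewPolynomial K) • x) = 𝓥.v (a * (sig K)^[i] μ) := by
  have hX : u ((X ^ i : SkewPolynomial K) • x) = 𝓥.v ((sig K)^[i] μ) := by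
    induction i with
    | zero => simpa using h
    | succ i ih =>
      rw [pow_succ', mul_smul, Function.iterate_succ_apply']
      exact hM.X_smul _ _ ih
  rw [← C_mul_X_pow_eq_monomial, mul_smul, hM.smul, hX, AddValuation.map_mul]

theorem le_monomial_smul (hM : IsHenselian 𝓥 u) {x : M} {μ : K} (h : 𝓥.v μ ≤ u x) (i : ℕ) (a : K) :
    𝓥.v (a * (sig K)^[i] μ) ≤ u ((monomial i a : SkewPolynomial K) • x) := by
  obtain ⟨μ', hμ'⟩ := 𝓥.exists_v_eq (u x)
  rw [hM.monomial_smul hμ'.symm]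
  exact 𝓥.v_mul_le_v_mul _ (𝓥.v_iterate_mono (h.trans_eq hμ'.symm) i)

theorem smul_eq_sum {p : SkewPolynomial K} {n : ℕ} (h : ∀ i, n ≤ i → p.coeff i = 0) (x : M) :
    p • x = ∑ i ∈ Finset.range n, (monomial i (p.coeff i) : SkewPolynomial K) • x := by
  conv_lhs => rw [eq_sum_monomial h]
  rw [Finset.sum_smul]

theorem le_smul (hM : IsHenselian 𝓥 u) {p : SkewPolynomial K} {x : M} {μ : K} {c : WithTop Γ}
    (h : 𝓥.v μ ≤ u x) (hp : ∀ i, c ≤ 𝓥.v (p.coeff i * (sig K)^[i] μ)) : c ≤ u (p • x) := by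
  obtain ⟨n, hn⟩ := exists_coeff_bound p
  rw [smul_eq_sum hn]
  exact hM.le_sum _ _ fun i _ => (hp i).trans (hM.le_monomial_smul h i _)

theorem lt_smul (hM : IsHenselian 𝓥 u) {p : SkewPolynomial K} {x : M} {μ : K} {c : WithTop Γ}
    (hc : c ≠ ⊤) (h : 𝓥.v μ ≤ u x) (hp : ∀ i, c < 𝓥.v (p.coeff i * (sig K)^[i] μ)) :
    c < u (p • x) := by
  obtain ⟨n, hn⟩ := exists_coeff_bound p
  rw [smul_eq_sum hn]
  exact hM.lt_sum _ _ hc fun i _ => (hp i).trans_le (hM.le_monomial_smul h i _)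

theorem le_C_smul_iff (hM : IsHenselian 𝓥 u) {a : K} (ha : a ≠ 0) (b : K) (x : M) :
    𝓥.v (a * b) ≤ u ((C a : SkewPolynomial K) • x) ↔ 𝓥.v b ≤ u x := by
  rw [hM.smul, AddValuation.map_mul]
  exact WithTop.add_le_add_iff_left (𝓥.v_ne_top ha)

theorem C_inv_smul_smul {a : K} (ha : a ≠ 0) (x : M) :
    (C a⁻¹ : SkewPolynomial K) • (C a : SkewPolynomial K) • x = x := by
  rw [smul_smul, ← C_mul, inv_mul_cancel₀ ha, C_1, one_smul]

theorem C_smul_inv_smul {a : K} (ha : a ≠ 0) (x : M) :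
    (C a : SkewPolynomial K) • (C a⁻¹ : SkewPolynomial K) • x = x := by
  rw [smul_smul, ← C_mul, mul_inv_cancel₀ ha, C_1, one_smul]

theorem isSep_scaled {q : SkewPolynomial K} (hq : IsSep q) {μ ν : K} (hμ : μ ≠ 0) (hν : ν ≠ 0) :
    IsSep (C ν⁻¹ * q * C μ) := by
  rw [IsSep, skew_coeff_mul_C, skew_coeff_C_mul]
  exact mul_ne_zero (mul_ne_zero (inv_ne_zero hν) hq) hμ

/-- The divisibility axiom at an arbitrary level. -/
theorem exists_smul_eq_of_level (hM : IsHenselian 𝓥 u) {q : SkewPolynomial K} (hq : IsSep q)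
    {μ ν : K} (hμ : μ ≠ 0) (hν : ν ≠ 0) (h : 𝓥.Level q μ ν) {y : M} (hy : 𝓥.v ν ≤ u y) :
    ∃ x, q • x = y ∧ 𝓥.v μ ≤ u x := by
  obtain ⟨z, hz, hqz⟩ := hM.div _ (h.mem_scrI 𝓥 hν) (isSep_scaled hq hμ hν)
    ((C ν⁻¹ : SkewPolynomial K) • y) (by
      rw [← 𝓥.v_one, ← inv_mul_cancel₀ hν, hM.le_C_smul_iff (inv_ne_zero hν)]
      exact hy)
  refine ⟨(C μ : SkewPolynomial K) • z, ?_, ?_⟩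
  · rw [mul_assoc, mul_smul] at hqz
    rw [← C_smul_inv_smul hν y, ← hqz, C_smul_inv_smul hν, mul_smul]
  · rw [← 𝓥.v_one] at hz
    simpa using (hM.le_C_smul_iff hμ 1 z).2 hz

/-- If `y` has at least the value of `q • x`, the equation `q • z = y` has a solution of at least
the value of `x`, possibly in another module. -/
theorem exists_smul_eq_of_le (hM : IsHenselian 𝓥 u) (hN : IsHenselian 𝓥 u')
    {q : SkewPolynomial K} (hq : IsSep q) (x : M) {y : N} (hy : u (q • x) ≤ u' y) :
    ∃ z, q • z = y ∧ u x ≤ u' z := by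
  obtain ⟨μ, hμ⟩ := 𝓥.exists_v_eq (u x)
  by_cases h0 : μ = 0
  · subst h0
    rw [AddValuation.map_zero, eq_comm, hM.eq_top] at hμ
    subst hμ
    rw [smul_zero, hM.map_zero, top_le_iff, hN.eq_top] at hy
    exact ⟨0, by rw [smul_zero, hy], by rw [hN.map_zero]; exact le_top⟩
  · obtain ⟨ν, hν, hlev⟩ := 𝓥.exists_level hq.ne_zero h0
    rw [← hμ]
    exact hN.exists_smul_eq_of_level hq h0 hν hlev ((hM.le_smul hμ.le hlev.1).trans hy)

theorem exists_smul_eq (hM : IsHenselian 𝓥 u)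
    (hσ : ∀ b : K, b ≠ 0 → ∃ a, 𝓥.v (sig K a) = 𝓥.v b) {q : SkewPolynomial K} (hq : IsSep q)
    (y : M) : ∃ x, q • x = y := by
  obtain ⟨ν, hν⟩ := 𝓥.exists_v_eq (u y)
  by_cases h0 : ν = 0
  · subst h0
    rw [AddValuation.map_zero, eq_comm, hM.eq_top] at hν
    exact ⟨0, by rw [smul_zero, hν]⟩
  · obtain ⟨μ, hμ, hlev⟩ := 𝓥.exists_level_of_surj hσ hq.ne_zero h0
    obtain ⟨x, hx, -⟩ := hM.exists_smul_eq_of_level hq hμ h0 hlev hν.le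
    exact ⟨x, hx⟩

/-- Regular solutions. -/
theorem exists_regular (hM : IsHenselian 𝓥 u) (hN : IsHenselian 𝓥 u')
    (hσ : ∀ b : K, b ≠ 0 → ∃ a, 𝓥.v (sig K a) = 𝓥.v b) {q : SkewPolynomial K} (hq : IsSep q)
    (y : M) : ∃ x, q • x = y ∧ ∀ z : N, u x ≤ u' z → u y ≤ u' (q • z) := by
  obtain ⟨ν, hν⟩ := 𝓥.exists_v_eq (u y)
  by_cases h0 : ν = 0
  · subst h0
    rw [AddValuation.map_zero, eq_comm, hM.eq_top] at hν
    refine ⟨0, by rw [smul_zero, hν], fun z hz => ?_⟩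
    rw [hM.map_zero, top_le_iff, hN.eq_top] at hz
    rw [hz, smul_zero, hN.map_zero]
    exact le_top
  · obtain ⟨μ, hμ, hlev⟩ := 𝓥.exists_level_of_surj hσ hq.ne_zero h0
    obtain ⟨x, hx, hux⟩ := hM.exists_smul_eq_of_level hq hμ h0 hlev hν.le
    refine ⟨x, hx, fun z hz => ?_⟩
    rw [← hν]
    exact hN.le_smul (hux.trans hz) hlev.1

/-- Solve at the level given by the exact value of `y`. Levels are monotone, so a strictly larger
target value forces a strictly larger radius for the solution. -/
theorem exists_smul_eq_of_level_lt (hM : IsHenselian 𝓥 u)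
    (hσ : ∀ b : K, b ≠ 0 → ∃ a, 𝓥.v (sig K a) = 𝓥.v b) {q : SkewPolynomial K} (hq : IsSep q)
    {μ ν : K} (hμ : μ ≠ 0) (h : 𝓥.Level q μ ν) {y : M} (hy : 𝓥.v ν < u y) :
    ∃ x, q • x = y ∧ 𝓥.v μ < u x := by
  obtain ⟨ν₁, hν₁⟩ := 𝓥.exists_v_eq (u y)
  by_cases h0 : ν₁ = 0
  · subst h0
    rw [AddValuation.map_zero, eq_comm, hM.eq_top] at hν₁
    refine ⟨0, by rw [smul_zero, hν₁], ?_⟩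
    rw [hM.map_zero]
    exact lt_top_iff_ne_top.2 (𝓥.v_ne_top hμ)
  · obtain ⟨μ₁, hμ₁, hlev⟩ := 𝓥.exists_level_of_surj hσ hq.ne_zero h0
    obtain ⟨x, hx, hux⟩ := hM.exists_smul_eq_of_level hq hμ₁ h0 hlev hν₁.le
    refine ⟨x, hx, lt_of_lt_of_le ?_ hux⟩
    by_contra hle
    have := hlev.le_of_le 𝓥 h (not_lt.1 hle)
    rw [hν₁] at this
    exact absurd hy (not_lt.2 this)

/-- The annihilator of a `σ`-separable skew polynomial is finite, and its cardinality depends only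
on the degree. -/
theorem card_annihilator (hM : IsHenselian 𝓥 u) (h_fix : {a : K | sig K a = a}.Finite)
    {q : SkewPolynomial K} (hq : IsSep q) {d : ℕ} (hd : HasDegree q d) :
    {m : M | q • m = 0}.Finite ∧
      {m : M | q • m = 0}.ncard = {a : K | sig K a = a}.ncard ^ d := by
  obtain ⟨ν, hν, hlev⟩ := 𝓥.exists_level hq.ne_zero one_ne_zero
  have hc : ∀ i, (C ν⁻¹ * q * C 1).coeff i = ν⁻¹ * q.coeff i := by
    intro i
    rw [C_1, mul_one, skew_coeff_C_mul]
  have hset : {m : M | q • m = 0} = {m : M | (C ν⁻¹ * q * C 1) • m = 0} := by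
    ext m
    change q • m = 0 ↔ (C ν⁻¹ * q * C 1) • m = 0
    rw [C_1, mul_one, mul_smul]
    refine ⟨fun h => by rw [h, smul_zero], fun h => ?_⟩
    rw [← C_smul_inv_smul hν (q • m), h, smul_zero]
  obtain ⟨h1, h2⟩ := hM.tor _ d (hlev.mem_scrI 𝓥 hν) (isSep_scaled hq one_ne_zero hν)
    ⟨by rw [hc]; exact mul_ne_zero (inv_ne_zero hν) hd.1,
      fun j hj => by rw [hc, hd.2 j hj, mul_zero]⟩
  rw [hset]
  exact card_annihilator_of_fixIndep h_fix h1 h2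

theorem finite_annihilator (hM : IsHenselian 𝓥 u) (h_fix : {a : K | sig K a = a}.Finite)
    {q : SkewPolynomial K} (hq : IsSep q) : {m : M | q • m = 0}.Finite := by
  obtain ⟨d, hd⟩ := exists_hasDegree hq.ne_zero
  exact (hM.card_annihilator h_fix hq hd).1

/-- If `u x` were negative, the values of `X ^ i • x` would strictly decrease in `i`. The leading
term, with its unit coefficient, would then have value strictly below all others and could not
cancel. -/
theorem integral_of_smul_eq_zero (hM : IsHenselian 𝓥 u) {s : SkewPolynomial K} {e : ℕ}
    (hs : ∀ i, 0 ≤ 𝓥.v (s.coeff i)) (he : 𝓥.v (s.coeff e) = 0)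
    (hdeg : ∀ j, e < j → s.coeff j = 0) {x : M} (hx : s • x = 0) : 0 ≤ u x := by
  by_contra hneg
  push Not at hneg
  obtain ⟨μ, hμ⟩ := 𝓥.exists_v_eq (u x)
  rw [← hμ] at hneg
  have h1 : u ((monomial e (s.coeff e) : SkewPolynomial K) • x) = 𝓥.v ((sig K)^[e] μ) := by
    rw [hM.monomial_smul hμ.symm, AddValuation.map_mul, he, zero_add]
  have htop : 𝓥.v ((sig K)^[e] μ) ≠ ⊤ := by
    have h0 := (𝓥.strictAnti_v_iterate hneg).antitone (Nat.zero_le e)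
    exact ((h0.trans_lt hneg).trans_le le_top).ne
  rw [smul_eq_sum (n := e + 1) (fun i hi => hdeg i (by omega)), Finset.sum_range_succ,
    add_eq_zero_iff_neg_eq] at hx
  rw [← hx, hM.map_neg] at h1
  refine absurd h1 (ne_of_gt (hM.lt_sum _ _ htop fun i hi => ?_))
  rw [hM.monomial_smul hμ.symm, AddValuation.map_mul]
  have h2 := 𝓥.strictAnti_v_iterate hneg (Finset.mem_range.1 hi)
  exact h2.trans_le (le_add_of_nonneg_left (hs i))

/-- The level of `q` at `μ`, with `v μ = u x`, is at most `v (σ^e μ)`. The terms of `t • x` all have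
index above `e` and coefficients of positive value, so `t • x` lies strictly above that level. The
resulting `y` is the correction that turns a solution for a truncation into one for the full
polynomial, and back. -/
theorem exists_closer (hM : IsHenselian 𝓥 u)
    (hσ : ∀ b : K, b ≠ 0 → ∃ a, 𝓥.v (sig K a) = 𝓥.v b) {q t : SkewPolynomial K} (hq : IsSep q)
    {e : ℕ} (he : 𝓥.v (q.coeff e) = 0) (ht : ∀ i, i ≤ e → t.coeff i = 0)
    (ht' : ∀ i, e < i → 0 < 𝓥.v (t.coeff i)) {x : M} (hx : 0 ≤ u x) (hx0 : x ≠ 0) :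
    ∃ y, q • y = t • x ∧ u x < u y := by
  obtain ⟨μ, hμ⟩ := 𝓥.exists_v_eq (u x)
  have hμ0 : μ ≠ 0 := 𝓥.ne_zero_of_v_ne_top (by rw [hμ]; exact fun h => hx0 ((hM.eq_top x).1 h))
  obtain ⟨ν, hν, hlev⟩ := 𝓥.exists_level hq.ne_zero hμ0
  have hνe : 𝓥.v ν ≤ 𝓥.v ((sig K)^[e] μ) := by
    have := hlev.1 e
    rwa [AddValuation.map_mul, he, zero_add] at this
  rw [← hμ] at hx ⊢
  refine hM.exists_smul_eq_of_level_lt hσ hq hμ0 hlev (hM.lt_smul (𝓥.v_ne_top hν) hμ.le ?_)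
  intro i
  rcases le_or_gt i e with hi | hi
  · rw [ht i hi, zero_mul, AddValuation.map_zero]
    exact lt_top_iff_ne_top.2 (𝓥.v_ne_top hν)
  · refine hνe.trans_lt ?_
    have h1 : 𝓥.v ((sig K)^[e] μ) ≤ 𝓥.v ((sig K)^[i] μ) := 𝓥.monotone_v_iterate hx hi.le
    refine h1.trans_lt ?_
    rw [AddValuation.map_mul]
    have hne : 𝓥.v ((sig K)^[i] μ) ≠ ⊤ := 𝓥.v_ne_top fun h => hμ0 (by
      rw [← iterate_map_zero (sig K) i] at h
      exact (Function.Injective.iterate (sig K).injective i) h)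
    calc 𝓥.v ((sig K)^[i] μ) = 0 + 𝓥.v ((sig K)^[i] μ) := (zero_add _).symm
      _ < _ := WithTop.add_lt_add_right hne (ht' i hi)

/-- Truncating `q` at `e` gives `s` of degree `e` with unit leading coefficient, so its annihilator
is integral and of known size. The remainder `q - s` is as in `exists_closer`, so the two groups of
integral solutions approximate each other and `card_le_of_approx` applies both ways. -/
theorem card_integral_annihilator (hM : IsHenselian 𝓥 u) (h_fix : {a : K | sig K a = a}.Finite)
    (hσ : ∀ b : K, b ≠ 0 → ∃ a, 𝓥.v (sig K a) = 𝓥.v b) {q : SkewPolynomial K} (hq : IsSep q)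
    (hqI : ∀ i, 0 ≤ 𝓥.v (q.coeff i)) {e : ℕ} (he : 𝓥.v (q.coeff e) = 0)
    (he' : ∀ i, e < i → 0 < 𝓥.v (q.coeff i)) :
    {m : M | q • m = 0 ∧ 0 ≤ u m}.ncard = {a : K | sig K a = a}.ncard ^ e := by
  set s : SkewPolynomial K := ∑ i ∈ Finset.range (e + 1), monomial i (q.coeff i) with hs
  have hsc : ∀ i, s.coeff i = if i ≤ e then q.coeff i else 0 := by
    intro i
    simp only [hs, skew_coeff_sum, coeff_monomial, Finset.sum_ite_eq', Finset.mem_range,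
      Nat.lt_succ_iff]
  have hsI : ∀ i, 0 ≤ 𝓥.v (s.coeff i) := by
    intro i
    rw [hsc]
    split_ifs
    · exact hqI i
    · rw [AddValuation.map_zero]; exact le_top
  have hse : s.coeff e = q.coeff e := by rw [hsc, if_pos le_rfl]
  have hssep : IsSep s := by
    rw [IsSep, hsc, if_pos (Nat.zero_le e)]
    exact hq
  have hsd : HasDegree s e := by
    refine ⟨?_, fun j hj => by rw [hsc, if_neg (not_le.2 hj)]⟩
    rw [hse]
    refine 𝓥.ne_zero_of_v_ne_top ?_
    rw [he]
    exact WithTop.zero_ne_top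
  obtain ⟨hfin, hcard⟩ := hM.card_annihilator h_fix hssep hsd
  let G : AddSubgroup M :=
    { carrier := {m | s • m = 0}
      add_mem' := fun {a b} (ha : s • a = 0) (hb : s • b = 0) => by
        change s • (a + b) = 0
        rw [smul_add, ha, hb, add_zero]
      zero_mem' := smul_zero s
      neg_mem' := fun {a} (ha : s • a = 0) => by
        change s • (-a) = 0
        rw [smul_neg, ha, neg_zero] }
  let H : AddSubgroup M :=
    { carrier := {m | q • m = 0 ∧ 0 ≤ u m}
      add_mem' := fun {a b} ha hb => by
        refine ⟨?_, hM.le_add ha.2 hb.2⟩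
        rw [smul_add, ha.1, hb.1, add_zero]
      zero_mem' := ⟨smul_zero q, by rw [hM.map_zero]; exact le_top⟩
      neg_mem' := fun {a} ha => by
        refine ⟨?_, ha.2.trans_eq (hM.map_neg a).symm⟩
        rw [smul_neg, ha.1, neg_zero] }
  have hG : Finite G := hfin
  have hH : Finite H := (hM.finite_annihilator h_fix hq).subset fun m hm => hm.1
  have hint : ∀ m ∈ G, 0 ≤ u m := fun m hm =>
    hM.integral_of_smul_eq_zero hsI (hse ▸ he) hsd.2 hm
  have ht : ∀ i, i ≤ e → (q - s).coeff i = 0 := fun i hi => by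
    rw [skew_coeff_sub, hsc, if_pos hi, sub_self]
  have ht' : ∀ i, e < i → 0 < 𝓥.v ((q - s).coeff i) := fun i hi => by
    rw [skew_coeff_sub, hsc, if_neg (not_le.2 hi), sub_zero]
    exact he' i hi
  have hGH : Nat.card G ≤ Nat.card H := by
    refine card_le_of_approx hM.min_le hM.map_neg hM.eq_top G H fun g hg hg0 => ?_
    obtain ⟨y, hy, hlt⟩ := hM.exists_closer hσ hq he ht ht' (hint g hg) hg0
    rw [sub_smul, show s • g = 0 from hg, sub_zero] at hy
    refine ⟨g - y, ⟨by rw [smul_sub, hy, sub_self], hM.le_sub (hint g hg)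
      ((hint g hg).trans hlt.le)⟩, ?_⟩
    rwa [sub_sub_cancel]
  have hHG : Nat.card H ≤ Nat.card G := by
    refine card_le_of_approx hM.min_le hM.map_neg hM.eq_top H G fun g hg hg0 => ?_
    obtain ⟨y, hy, hlt⟩ := hM.exists_closer hσ hssep (hse ▸ he) ht ht' hg.2 hg0
    rw [sub_smul, hg.1, zero_sub] at hy
    refine ⟨g + y, ?_, ?_⟩
    · change s • (g + y) = 0
      rw [smul_add, hy, add_neg_cancel]
    · rwa [sub_add_cancel_left, hM.map_neg]
  rw [← hcard]
  exact le_antisymm hHG hGH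

theorem C_smul_injective {a : K} (ha : a ≠ 0) :
    Function.Injective fun m : M => (C a : SkewPolynomial K) • m := fun x y h => by
  rw [← C_inv_smul_smul ha x, ← C_inv_smul_smul ha y]
  exact congrArg _ h

theorem annihilator_ball_eq_image (hM : IsHenselian 𝓥 u) {q : SkewPolynomial K} {μ ν : K}
    (hμ : μ ≠ 0) (hν : ν ≠ 0) : {m : M | q • m = 0 ∧ 𝓥.v μ ≤ u m} =
      (fun m => (C μ : SkewPolynomial K) • m) '' {m : M | (C ν⁻¹ * q * C μ) • m = 0 ∧ 0 ≤ u m} := by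
  ext m
  constructor
  · rintro ⟨h1, h2⟩
    refine ⟨(C μ⁻¹ : SkewPolynomial K) • m, ⟨?_, ?_⟩, C_smul_inv_smul hμ m⟩
    · rw [mul_smul, C_smul_inv_smul hμ, mul_smul, h1, smul_zero]
    · rw [← 𝓥.v_one, ← inv_mul_cancel₀ hμ, hM.le_C_smul_iff (inv_ne_zero hμ)]
      exact h2
  · rintro ⟨z, ⟨h1, h2⟩, rfl⟩
    refine ⟨?_, ?_⟩
    · rw [mul_assoc, mul_smul] at h1
      rw [smul_smul, ← C_smul_inv_smul hν ((q * C μ) • z), h1, smul_zero]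
    · rw [← 𝓥.v_one] at h2
      simpa using (hM.le_C_smul_iff hμ 1 z).2 h2

/-- The number of elements of value at least `v μ` in the annihilator of a `σ`-separable skew
polynomial does not depend on the module. -/
theorem card_annihilator_ball (hM : IsHenselian 𝓥 u) (hN : IsHenselian 𝓥 u')
    (h_fix : {a : K | sig K a = a}.Finite)
    (hσ : ∀ b : K, b ≠ 0 → ∃ a, 𝓥.v (sig K a) = 𝓥.v b) {q : SkewPolynomial K} (hq : IsSep q)
    {μ : K} (hμ : μ ≠ 0) :
    {m : M | q • m = 0 ∧ 𝓥.v μ ≤ u m}.ncard = {m : N | q • m = 0 ∧ 𝓥.v μ ≤ u' m}.ncard := by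
  classical
  obtain ⟨ν, hν, hlev⟩ := 𝓥.exists_level hq.ne_zero hμ
  set p : SkewPolynomial K := C ν⁻¹ * q * C μ with hp
  have hpsep : IsSep p := isSep_scaled hq hμ hν
  have hpI : p ∈ 𝓥.scrI := hlev.mem_scrI 𝓥 hν
  -- The last unit coefficient of the rescaled polynomial: its index depends on `q` and `μ` only,
  -- and it determines the count in both modules.
  obtain ⟨e, he, he'⟩ : ∃ e, 𝓥.v (p.coeff e) = 0 ∧ ∀ i, e < i → 0 < 𝓥.v (p.coeff i) := by
    obtain ⟨e, he, hmax⟩ := (p.support.filter fun i => 𝓥.v (p.coeff i) = 0).exists_max_image id (by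
      obtain ⟨i, hi⟩ := hpI.2
      refine ⟨i, Finset.mem_filter.2 ⟨mem_support_iff.2 (𝓥.ne_zero_of_v_ne_top ?_), hi⟩⟩
      rw [hi]; exact WithTop.zero_ne_top)
    refine ⟨e, (Finset.mem_filter.1 he).2, fun i hi => lt_of_le_of_ne (hpI.1 i) fun h0 => ?_⟩
    refine absurd (hmax i (Finset.mem_filter.2 ⟨mem_support_iff.2 (𝓥.ne_zero_of_v_ne_top ?_),
      h0.symm⟩)) (not_le.2 hi)
    rw [← h0]; exact WithTop.zero_ne_top
  rw [hM.annihilator_ball_eq_image hμ hν, hN.annihilator_ball_eq_image hμ hν,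
    Set.ncard_image_of_injective _ (C_smul_injective hμ),
    Set.ncard_image_of_injective _ (C_smul_injective hμ),
    hM.card_integral_annihilator h_fix hσ hpsep hpI.1 he he',
    hN.card_integral_annihilator h_fix hσ hpsep hpI.1 he he']

end IsHenselian

end ValuedModule

/-! ### Partial isometries and their one-step extensions -/

section PartialIsometry

variable {K Γ : Type*} [Field K] [MulSemiringAction (Multiplicative ℕ) K]
  [AddCommGroup Γ] [LinearOrder Γ] [IsOrderedAddMonoid Γ] {𝓥 : ContractiveValuation K Γ}
  {M N : Type*} [AddCommGroup M] [Module (SkewPolynomial K) M]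
  [AddCommGroup N] [Module (SkewPolynomial K) N]

/-- The domain of a linear relation. -/
noncomputable def relDom (G : Submodule (SkewPolynomial K) (M × N)) : Submodule (SkewPolynomial K) M :=
  G.map (LinearMap.fst (SkewPolynomial K) M N)

theorem mem_relDom {G : Submodule (SkewPolynomial K) (M × N)} {x : M} :
    x ∈ relDom G ↔ ∃ y, (x, y) ∈ G := by
  constructor
  · rintro ⟨z, hz, rfl⟩
    exact ⟨z.2, hz⟩
  · rintro ⟨y, hy⟩
    exact ⟨(x, y), hy, rfl⟩

/-- The converse of a linear relation. -/
noncomputable def relSwap (G : Submodule (SkewPolynomial K) (M × N)) : Submodule (SkewPolynomial K) (N × M) :=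
  G.comap (LinearEquiv.prodComm (SkewPolynomial K) N M).toLinearMap

theorem mem_relDom_relSwap {G : Submodule (SkewPolynomial K) (M × N)} {y : N} :
    y ∈ relDom (relSwap G) ↔ ∃ x, (x, y) ∈ G := mem_relDom

/-- A linear relation that preserves values. It is the graph of an isomorphism between
submodules. -/
def IsPartialIsometry (u : M → WithTop Γ) (u' : N → WithTop Γ)
    (G : Submodule (SkewPolynomial K) (M × N)) : Prop :=
  ∀ x y, (x, y) ∈ G → u x = u' y

variable {u : M → WithTop Γ} {u' : N → WithTop Γ} {G : Submodule (SkewPolynomial K) (M × N)}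

theorem IsPartialIsometry.swap (hG : IsPartialIsometry u u' G) :
    IsPartialIsometry u' u (relSwap G) := fun y x h => (hG x y h).symm

theorem IsPartialIsometry.right_unique (hM : IsHenselian 𝓥 u) (hN : IsHenselian 𝓥 u')
    (hG : IsPartialIsometry u u' G) {x : M} {y y' : N} (h : (x, y) ∈ G) (h' : (x, y') ∈ G) :
    y = y' := by
  have h1 : u (x - x) = u' (y - y') := hG _ _ (G.sub_mem h h')
  rw [sub_self, hM.map_zero, eq_comm, hN.eq_top, sub_eq_zero] at h1
  exact h1

theorem IsPartialIsometry.left_unique (hM : IsHenselian 𝓥 u) (hN : IsHenselian 𝓥 u')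
    (hG : IsPartialIsometry u u' G) {x x' : M} {y : N} (h : (x, y) ∈ G) (h' : (x', y) ∈ G) :
    x = x' := hG.swap.right_unique hN hM h h'

theorem smul_mem_rel (p : SkewPolynomial K) {x : M} {y : N} (h : (x, y) ∈ G) :
    (p • x, p • y) ∈ G := G.smul_mem p h

theorem add_mem_rel {x x' : M} {y y' : N} (h : (x, y) ∈ G) (h' : (x', y') ∈ G) :
    (x + x', y + y') ∈ G := G.add_mem h h'

theorem sub_mem_rel {x x' : M} {y y' : N} (h : (x, y) ∈ G) (h' : (x', y') ∈ G) :
    (x - x', y - y') ∈ G := G.sub_mem h h'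

/-- Solution sets of a `σ`-separable equation are finite. -/
theorem IsHenselian.finite_solutions (hM : IsHenselian 𝓥 u)
    (h_fix : {a : K | sig K a = a}.Finite) {q : SkewPolynomial K} (hq : IsSep q) (x : M) :
    {m : M | q • m = x}.Finite := by
  by_cases h : ∃ m, q • m = x
  · obtain ⟨m, rfl⟩ := h
    refine ((hM.finite_annihilator h_fix hq).image (m + ·)).subset fun z (hz : q • z = q • m) => ?_
    refine ⟨z - m, ?_, add_sub_cancel _ _⟩
    change q • (z - m) = 0
    rw [smul_sub, hz, sub_self]
  · convert Set.finite_empty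
    exact Set.eq_empty_of_forall_notMem fun m hm => h ⟨m, hm⟩

/-- Among the solutions of the corresponding equation in `N`, some are at least as close to the
range of `G` as `m` is to the domain. -/
theorem IsPartialIsometry.exists_dominating (hM : IsHenselian 𝓥 u) (hN : IsHenselian 𝓥 u')
    (h_fix : {a : K | sig K a = a}.Finite) (hG : IsPartialIsometry u u' G)
    {q : SkewPolynomial K} (hq : IsSep q) {m : M} {x' : N} (h : (q • m, x') ∈ G) :
    ∃ n, q • n = x' ∧ ∀ x y, (x, y) ∈ G → u (m + x) ≤ u' (n + y) := by
  by_contra hcon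
  push Not at hcon
  -- For a single pair it suffices to solve `q • z = x' + q • y` and subtract `y`; finiteness then
  -- makes the choice uniform.
  have hone : ∀ x y, (x, y) ∈ G → ∃ n, q • n = x' ∧ u (m + x) ≤ u' (n + y) := by
    intro x y hxy
    obtain ⟨z, hz, hle⟩ := hM.exists_smul_eq_of_le hN hq (m + x) (y := x' + q • y) (by
      rw [smul_add]
      exact (hG _ _ (add_mem_rel h (smul_mem_rel q hxy))).le)
    refine ⟨z - y, ?_, by rwa [sub_add_cancel]⟩
    rw [smul_sub, hz, add_sub_cancel_right]
  choose! f g hfg hlt using hcon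
  obtain ⟨n₀, hn₀, -⟩ := hone 0 0 G.zero_mem
  -- Among the finitely many solutions, `n₁` has the counterexample `f n₁` closest to `m`. A
  -- solution `n` that is good for this pair is, by the ultrametric inequality, also good for its
  -- own counterexample.
  obtain ⟨n₁, hn₁, hmax⟩ := Set.exists_max_image {n : N | q • n = x'} (fun n => u (m + f n))
    (hN.finite_solutions h_fix hq x') ⟨n₀, hn₀⟩
  obtain ⟨n, hn, hle⟩ := hone _ _ (hfg n₁ hn₁)
  refine absurd (hlt n hn) (not_lt.2 ?_)
  have h1 : u (m + f n) ≤ u' (n + g n₁) := (hmax n hn).trans hle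
  have h2 : u (m + f n) ≤ u' (g n₁ - g n) := by
    rw [← hG _ _ (sub_mem_rel (hfg n₁ hn₁) (hfg n hn)),
      show f n₁ - f n = (m + f n₁) - (m + f n) by abel]
    exact hM.le_sub (hmax n hn) le_rfl
  have h3 := hN.le_sub h1 h2
  rwa [show n + g n₁ - (g n₁ - g n) = n + g n by abel] at h3

/-- If the dominating `n` corresponds to some `m'` in the domain, then `m - m'` is annihilated by
`q`, lies outside the domain, and has value at least every `u (m + x)`. Equality of the ball counts
yields a `b` annihilated by `q`, of at least that value and outside the range; `n + b` is the
required solution. -/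
theorem IsPartialIsometry.exists_dominating_notMem (hM : IsHenselian 𝓥 u)
    (hN : IsHenselian 𝓥 u') (h_fix : {a : K | sig K a = a}.Finite)
    (hσ : ∀ b : K, b ≠ 0 → ∃ a, 𝓥.v (sig K a) = 𝓥.v b) (hG : IsPartialIsometry u u' G)
    {q : SkewPolynomial K} (hq : IsSep q) {m : M} {x' : N} (hm : m ∉ relDom G)
    (h : (q • m, x') ∈ G) :
    ∃ n, q • n = x' ∧ n ∉ relDom (relSwap G) ∧ ∀ x y, (x, y) ∈ G → u (m + x) ≤ u' (n + y) := by
  obtain ⟨n, hn, hle⟩ := hG.exists_dominating hM hN h_fix hq h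
  by_cases hnr : n ∈ relDom (relSwap G)
  swap
  · exact ⟨n, hn, hnr, hle⟩
  obtain ⟨m', hm'⟩ := mem_relDom_relSwap.1 hnr
  have hqm : q • m' = q • m := by
    refine hG.left_unique hM hN (y := x') ?_ h
    rw [← hn]
    exact smul_mem_rel q hm'
  have ha0 : q • (m - m') = 0 := by rw [smul_sub, hqm, sub_self]
  have haD : m - m' ∉ relDom G := fun hc => hm (by
    have := (relDom G).add_mem hc (mem_relDom.2 ⟨n, hm'⟩)
    rwa [sub_add_cancel] at this)
  have hdist : ∀ x y, (x, y) ∈ G → u (m + x) ≤ u (m - m') := by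
    intro x y hxy
    have h1 : u (m + x) ≤ u (m' + x) := by
      rw [hG _ _ (add_mem_rel hm' hxy)]
      exact hle x y hxy
    have := hM.le_sub le_rfl h1
    rwa [add_sub_add_right_eq_sub] at this
  obtain ⟨μ, hμ⟩ := 𝓥.exists_v_eq (u (m - m'))
  have hμ0 : μ ≠ 0 := 𝓥.ne_zero_of_v_ne_top (by
    rw [hμ]
    intro hc
    rw [hM.eq_top] at hc
    rw [hc] at haD
    exact haD (zero_mem _))
  obtain ⟨b, hb0, hbu, hbR⟩ : ∃ b : N, q • b = 0 ∧ 𝓥.v μ ≤ u' b ∧ b ∉ relDom (relSwap G) := by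
    by_contra hcon
    push Not at hcon
    have hex : ∀ b : N, ∃ a : M, q • b = 0 ∧ 𝓥.v μ ≤ u' b → (a, b) ∈ G := by
      intro b
      by_cases hb : q • b = 0 ∧ 𝓥.v μ ≤ u' b
      · obtain ⟨a, ha⟩ := mem_relDom_relSwap.1 (hcon b hb.1 hb.2)
        exact ⟨a, fun _ => ha⟩
      · exact ⟨0, fun hc => absurd hc hb⟩
    choose φ hφ using hex
    -- The inclusion is strict because `m - m'` is in the ball but not in the domain, whereas `φ` is
    -- injective on a set of the same size.
    have hsub : φ '' {b : N | q • b = 0 ∧ 𝓥.v μ ≤ u' b} ⊂ {a : M | q • a = 0 ∧ 𝓥.v μ ≤ u a} := by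
      refine ⟨?_, fun hc => ?_⟩
      · rintro _ ⟨b, hb, rfl⟩
        have hab := hφ b hb
        refine ⟨?_, ?_⟩
        · refine hG.left_unique hM hN (smul_mem_rel q hab) ?_
          rw [hb.1]
          exact G.zero_mem
        · rw [hG _ _ hab]
          exact hb.2
      · obtain ⟨b, hb, hbe⟩ := hc ⟨ha0, hμ.le⟩
        exact haD (hbe ▸ mem_relDom.2 ⟨b, hφ b hb⟩)
    have hlt := Set.ncard_lt_ncard hsub
      ((hM.finite_annihilator h_fix hq).subset fun a ha => ha.1)
    rw [Set.InjOn.ncard_image, hM.card_annihilator_ball hN h_fix hσ hq hμ0] at hlt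
    · exact lt_irrefl _ hlt
    · intro b hb b' hb' hbb
      exact hG.right_unique hM hN (hφ b hb) (hbb ▸ hφ b' hb')
  refine ⟨n + b, by rw [smul_add, hn, hb0, add_zero], fun hc => hbR ?_, fun x y hxy => ?_⟩
  · have := (relDom (relSwap G)).sub_mem hc hnr
    rwa [add_sub_cancel_left] at this
  · rw [add_right_comm]
    exact hN.le_add (hle x y hxy) ((hdist x y hxy).trans (hμ.ge.trans hbu))

/-- A submodule is closed in degree less than `d` if it contains all solutions of `σ`-separable
equations of degree less than `d` with right hand side in the submodule. -/
def IsSepClosedBelow (d : ℕ) (D : Submodule (SkewPolynomial K) M) : Prop :=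
  ∀ p : SkewPolynomial K, IsSep p → (∀ j, d ≤ j → p.coeff j = 0) → ∀ z, p • z ∈ D → z ∈ D

/-- A nonzero `r` of least degree with `r • m ∈ D` divides `q` on the right, so it is separable like
`q`. If its degree were below `d`, closedness would put `m` in `D`. -/
theorem IsSepClosedBelow.eq_zero_of_smul_mem {d : ℕ} {D : Submodule (SkewPolynomial K) M}
    (hD : IsSepClosedBelow d D) {q : SkewPolynomial K} (hq : IsSep q) {m : M} (hm : m ∉ D)
    (hqm : q • m ∈ D) {p : SkewPolynomial K} (hp : ∀ j, d ≤ j → p.coeff j = 0)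
    (hpm : p • m ∈ D) : p = 0 := by
  classical
  by_contra hp0
  have hex : ∃ e, ∃ r : SkewPolynomial K, HasDegree r e ∧ r • m ∈ D := by
    obtain ⟨e, he⟩ := exists_hasDegree hp0
    exact ⟨e, p, he, hpm⟩
  obtain ⟨r, hr, hrm⟩ := Nat.find_spec hex
  obtain ⟨s, t, hst, ht⟩ := exists_eq_mul_add hr q
  have ht0 : t = 0 := by
    by_contra ht0
    obtain ⟨k, hk⟩ := exists_hasDegree ht0
    have hkr : k < Nat.find hex := by
      by_contra hc
      exact hk.1 (ht k (not_lt.1 hc))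
    refine Nat.find_min hex hkr ⟨t, hk, ?_⟩
    have : t = q - s * r := by rw [hst, add_sub_cancel_left]
    rw [this, sub_smul, mul_smul]
    exact D.sub_mem hqm (D.smul_mem s hrm)
  rw [ht0, add_zero] at hst
  have hrs : IsSep r := by
    intro h0
    apply hq
    rw [hst, coeff_zero_mul, h0, mul_zero]
  have hle : Nat.find hex < d := by
    obtain ⟨e, he⟩ := exists_hasDegree hp0
    refine lt_of_le_of_lt (Nat.find_min' hex ⟨p, he, hpm⟩) ?_
    by_contra hc
    exact he.1 (hp e (not_lt.1 hc))
  exact hm (hD r hrs (fun j hj => hr.2 j (hle.trans_le hj)) m hrm)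

/-- Closedness lets one write `x = p • z` with `z` in the domain, so the element is `p • (m + z)`. A
regular solution of the same equation differs from `m + z` by an element annihilated by `p`, again
in the domain. Hence `hmn` applies to it, and regularity bounds the value in `N`. -/
theorem IsPartialIsometry.le_sep_smul_add (hM : IsHenselian 𝓥 u) (hN : IsHenselian 𝓥 u')
    (hσ : ∀ b : K, b ≠ 0 → ∃ a, 𝓥.v (sig K a) = 𝓥.v b) (hG : IsPartialIsometry u u' G)
    {d : ℕ} (hD : IsSepClosedBelow d (relDom G)) {m : M} {n : N}
    (hmn : ∀ x y, (x, y) ∈ G → u (m + x) = u' (n + y)) {p : SkewPolynomial K} (hp : IsSep p)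
    (hpd : ∀ j, d ≤ j → p.coeff j = 0) {x : M} {y : N} (hxy : (x, y) ∈ G) :
    u (p • m + x) ≤ u' (p • n + y) := by
  obtain ⟨z, hz⟩ := hM.exists_smul_eq hσ hp x
  obtain ⟨z', hz'⟩ := mem_relDom.1 (hD p hp hpd z (hz ▸ mem_relDom.2 ⟨y, hxy⟩))
  have hy : p • z' = y := hG.right_unique hM hN (smul_mem_rel p hz') (hz.symm ▸ hxy)
  obtain ⟨r, hr, hreg⟩ := hM.exists_regular hN hσ hp (p • (m + z))
  have ha : p • (r - (m + z)) = 0 := by rw [smul_sub, hr, sub_self]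
  obtain ⟨b, hb⟩ := mem_relDom.1 (hD p hp hpd (r - (m + z)) (ha.symm ▸ zero_mem _))
  have hpb : p • b = 0 :=
    hG.right_unique hM hN (smul_mem_rel p hb) (ha.symm ▸ G.zero_mem)
  have h1 := hmn _ _ (add_mem_rel hz' hb)
  rw [← add_assoc, add_sub_cancel] at h1
  have h2 := hreg _ h1.le
  rwa [smul_add, hz, smul_add, smul_add, hpb, add_zero, hy] at h2

theorem exists_small_smul (hM : IsHenselian 𝓥 u) {m : M} (hm : m ≠ 0) {γ : WithTop Γ}
    (hγ : γ ≠ ⊤) : ∃ b : K, b ≠ 0 ∧ ∀ c : K, 𝓥.v b ≤ 𝓥.v c → γ ≤ u ((C c : SkewPolynomial K) • m) := by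
  obtain ⟨α, hα⟩ := 𝓥.exists_v_eq (u m)
  have hα0 : α ≠ 0 := 𝓥.ne_zero_of_v_ne_top (by rw [hα]; exact fun h => hm ((hM.eq_top m).1 h))
  obtain ⟨β, rfl⟩ := 𝓥.exists_v_eq γ
  refine ⟨α⁻¹ * β, mul_ne_zero (inv_ne_zero hα0) (𝓥.ne_zero_of_v_ne_top hγ), fun c hc => ?_⟩
  rw [hM.smul, ← hα, add_comm, ← AddValuation.map_mul, ← mul_inv_cancel_left₀ hα0 β]
  exact 𝓥.v_mul_le_v_mul α hc

/-- A `p` with zero constant coefficient is made separable by adding a constant `b` of value so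
large that `b • m` and `b • n` do not affect the comparison. -/
theorem IsPartialIsometry.le_smul_add (hM : IsHenselian 𝓥 u) (hN : IsHenselian 𝓥 u')
    (hσ : ∀ b : K, b ≠ 0 → ∃ a, 𝓥.v (sig K a) = 𝓥.v b) (hG : IsPartialIsometry u u' G)
    {d : ℕ} (hd : 0 < d) (hD : IsSepClosedBelow d (relDom G)) {q : SkewPolynomial K}
    (hq : IsSep q) {m : M} {n : N} (hm : m ∉ relDom G) (hqm : q • m ∈ relDom G) (hn : n ≠ 0)
    (hmn : ∀ x y, (x, y) ∈ G → u (m + x) = u' (n + y)) {p : SkewPolynomial K}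
    (hpd : ∀ j, d ≤ j → p.coeff j = 0) {x : M} {y : N} (hxy : (x, y) ∈ G) :
    u (p • m + x) ≤ u' (p • n + y) := by
  by_cases hp : IsSep p
  · exact hG.le_sep_smul_add hM hN hσ hD hmn hp hpd hxy
  rw [IsSep, not_not] at hp
  by_cases h0 : p • m + x = 0
  · have hp0 : p = 0 := hD.eq_zero_of_smul_mem hq hm hqm hpd (by
      rw [add_eq_zero_iff_eq_neg] at h0
      rw [h0]
      exact (relDom G).neg_mem (mem_relDom.2 ⟨y, hxy⟩))
    rw [hp0, zero_smul, zero_smul, zero_add, zero_add]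
    exact (hG x y hxy).le
  have hγ : u (p • m + x) ≠ ⊤ := fun h => h0 ((hM.eq_top _).1 h)
  have hm0 : m ≠ 0 := fun h => hm (h ▸ zero_mem _)
  obtain ⟨b₁, hb₁, h₁⟩ := exists_small_smul hM hm0 hγ
  obtain ⟨b₂, hb₂, h₂⟩ := exists_small_smul hN hn hγ
  obtain ⟨b, hb, hbm, hbn⟩ : ∃ b : K, b ≠ 0 ∧ u (p • m + x) ≤ u ((C b : SkewPolynomial K) • m) ∧
      u (p • m + x) ≤ u' ((C b : SkewPolynomial K) • n) := by
    rcases le_total (𝓥.v b₁) (𝓥.v b₂) with h | h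
    · exact ⟨b₂, hb₂, h₁ _ h, h₂ _ le_rfl⟩
    · exact ⟨b₁, hb₁, h₁ _ le_rfl, h₂ _ h⟩
  have h3 := hG.le_sep_smul_add hM hN hσ hD hmn (p := p + C b)
    (by rw [IsSep, skew_coeff_add, hp, zero_add, coeff_C_zero]; exact hb)
    (fun j hj => by
      rw [skew_coeff_add, hpd j hj, zero_add, coeff_C_ne_zero (by omega)]) hxy
  rw [add_smul, add_smul, add_right_comm, add_right_comm (p • n)] at h3
  have h4 := hN.le_sub ((hM.le_add le_rfl hbm).trans h3) hbn
  rwa [add_sub_cancel_right] at h4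

/-- A missing solution on the range side would produce one on the domain side, by
`exists_dominating_notMem` for the converse relation. -/
theorem IsPartialIsometry.isSepClosedBelow_swap (hM : IsHenselian 𝓥 u) (hN : IsHenselian 𝓥 u')
    (h_fix : {a : K | sig K a = a}.Finite)
    (hσ : ∀ b : K, b ≠ 0 → ∃ a, 𝓥.v (sig K a) = 𝓥.v b) (hG : IsPartialIsometry u u' G)
    {d : ℕ} (hD : IsSepClosedBelow d (relDom G)) : IsSepClosedBelow d (relDom (relSwap G)) := by
  intro p hp hpd z hz
  by_contra hzn
  obtain ⟨x, hx⟩ := mem_relDom.1 hz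
  obtain ⟨m, hm, hmn, -⟩ := hG.swap.exists_dominating_notMem hN hM h_fix hσ hp hzn hx
  exact hmn (hD p hp hpd m (hm ▸ mem_relDom.2 ⟨_, hx⟩))

/-- A partial isometry whose domain is not closed under solutions of `σ`-separable equations has a
proper extension. -/
theorem IsPartialIsometry.exists_extension (hM : IsHenselian 𝓥 u) (hN : IsHenselian 𝓥 u')
    (h_fix : {a : K | sig K a = a}.Finite)
    (hσ : ∀ b : K, b ≠ 0 → ∃ a, 𝓥.v (sig K a) = 𝓥.v b) (hG : IsPartialIsometry u u' G)
    (hex : ∃ q : SkewPolynomial K, IsSep q ∧ ∃ m, m ∉ relDom G ∧ q • m ∈ relDom G) :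
    ∃ (q : SkewPolynomial K) (m : M) (n : N), IsSep q ∧ m ∉ relDom G ∧ (q • m, q • n) ∈ G ∧
      IsPartialIsometry u u' (G ⊔ Submodule.span (SkewPolynomial K) {(m, n)}) := by
  classical
  have hex' : ∃ d, ∃ q : SkewPolynomial K, HasDegree q d ∧ IsSep q ∧
      ∃ m, m ∉ relDom G ∧ q • m ∈ relDom G := by
    obtain ⟨q, hq, h⟩ := hex
    obtain ⟨d, hd⟩ := exists_hasDegree hq.ne_zero
    exact ⟨d, q, hd, hq, h⟩
  obtain ⟨q, hqd, hq, m₀, hm₀, hqm₀⟩ := Nat.find_spec hex'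
  set d := Nat.find hex' with hd
  have hD : IsSepClosedBelow d (relDom G) := by
    intro p hp hpd z hz
    by_contra hzn
    obtain ⟨e, he⟩ := exists_hasDegree hp.ne_zero
    have hed : e < d := by
      by_contra hc
      exact he.1 (hpd e (not_lt.1 hc))
    exact Nat.find_min hex' hed ⟨p, he, hp, z, hzn, hz⟩
  have hD' := hG.isSepClosedBelow_swap hM hN h_fix hσ hD
  -- A separable constant is invertible. Positivity is what allows `le_smul_add` to perturb by
  -- constants without leaving degree below `d`.
  have hdpos : 0 < d := by
    rw [Nat.pos_iff_ne_zero]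
    intro h0
    have hqC : q = C (q.coeff 0) := by
      refine skew_ext fun i => ?_
      rw [coeff_C]
      split_ifs with hi
      · rw [hi]
      · exact hqd.2 i (by omega)
    have := (relDom G).smul_mem (C (q.coeff 0)⁻¹) hqm₀
    rw [hqC, coeff_C_zero, IsHenselian.C_inv_smul_smul hq] at this
    exact hm₀ this
  obtain ⟨x', hx'⟩ := mem_relDom.1 hqm₀
  -- The solution outside the domain is chosen with the largest cut of values below some `u (m +
  -- x)`. The suprema need not be attained, so cuts are compared by inclusion.
  obtain ⟨m, ⟨hqm, hm⟩, hmax⟩ := Set.Finite.exists_maximalFor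
    (fun m : M => {γ : WithTop Γ | ∃ x y, (x, y) ∈ G ∧ γ ≤ u (m + x)})
    {m : M | q • m = q • m₀ ∧ m ∉ relDom G}
    ((hM.finite_solutions h_fix hq (q • m₀)).subset fun m hm => hm.1) ⟨m₀, rfl, hm₀⟩
  rw [← hqm] at hx'
  obtain ⟨n, hn, hnR, hle⟩ := hG.exists_dominating_notMem hM hN h_fix hσ hq hm hx'
  obtain ⟨m₁, hm₁, hm₁D, hle₁⟩ := hG.swap.exists_dominating_notMem hN hM h_fix hσ hq hnR
    (x' := q • m) (by rw [hn]; exact hx')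
  have hmn : ∀ x y, (x, y) ∈ G → u (m + x) = u' (n + y) := by
    intro x y hxy
    refine le_antisymm (hle x y hxy) ?_
    have hcut := hmax (j := m₁) ⟨hm₁.trans hqm, hm₁D⟩ (by
      rintro γ ⟨x₁, y₁, h₁, hγ⟩
      exact ⟨x₁, y₁, h₁, hγ.trans ((hle _ _ h₁).trans (hle₁ _ _ h₁))⟩)
    -- Maximality only bounds `u (m₁ + x)` by `u (m + x₂)` for some other `x₂`. The isometry on `x -
    -- x₂` brings the bound back to `x`.
    obtain ⟨x₂, y₂, h₂, hγ⟩ := hcut (show u (m₁ + x) ∈ _ from ⟨x, y, hxy, le_rfl⟩)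
    have h3 : u' (n + y) ≤ u (m + x₂) := (hle₁ _ _ hxy).trans hγ
    have h4 : u' (n + y) ≤ u (x - x₂) := by
      rw [hG _ _ (sub_mem_rel hxy h₂), show y - y₂ = (n + y) - (n + y₂) by abel]
      exact hN.le_sub le_rfl (h3.trans (hle _ _ h₂))
    have h5 := hM.le_add h3 h4
    rwa [show m + x₂ + (x - x₂) = m + x by abel] at h5
  have hn0 : n ≠ 0 := fun h => hnR (h ▸ zero_mem _)
  have hm0 : m ≠ 0 := fun h => hm (h ▸ zero_mem _)
  refine ⟨q, m, n, hq, hm, hn.symm ▸ hx', ?_⟩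
  intro a b hab
  obtain ⟨⟨x, y⟩, hxy, ⟨a', b'⟩, hs, hsum⟩ := Submodule.mem_sup.1 hab
  obtain ⟨p, hp⟩ := Submodule.mem_span_singleton.1 hs
  obtain ⟨s, r, hpr, hr⟩ := exists_eq_mul_add hqd p
  simp only [Prod.smul_mk, Prod.mk.injEq] at hp
  simp only [Prod.mk_add_mk, Prod.mk.injEq] at hsum
  -- After dividing `p` by `q`, the multiple of `q` is absorbed into `G` and only a remainder of
  -- degree below `d` acts on `(m, n)`.
  have hxy' : (s • (q • m) + x, s • (q • n) + y) ∈ G :=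
    add_mem_rel (smul_mem_rel s (hn.symm ▸ hx')) hxy
  have ha : a = r • m + (s • (q • m) + x) := by
    rw [← hsum.1, ← hp.1, hpr, add_smul, mul_smul]; abel
  have hb : b = r • n + (s • (q • n) + y) := by
    rw [← hsum.2, ← hp.2, hpr, add_smul, mul_smul]; abel
  rw [ha, hb]
  refine le_antisymm (hG.le_smul_add hM hN hσ hdpos hD hq hm (mem_relDom.2 ⟨_, hx'⟩) hn0 hmn hr hxy')
    (hG.swap.le_smul_add hN hM hσ hdpos hD' hq hnR (mem_relDom.2 ⟨q • m, ?_⟩) hm0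
      (fun y x h => (hmn x y h).symm) hr hxy')
  rw [hn]
  exact hx'

end PartialIsometry

/-! ### The Ore condition and the torsion submodule -/

section Torsion

variable {K : Type*} [Field K] [MulSemiringAction (Multiplicative ℕ) K]
  {M : Type*} [AddCommGroup M] [Module (SkewPolynomial K) M]

theorem coeff_succ_mul_X (p : SkewPolynomial K) (i : ℕ) : (p * X).coeff (i + 1) = p.coeff i := by
  refine skew_induction (P := fun p => (p * X).coeff (i + 1) = p.coeff i) ?_ ?_ p
  · intro p q hp hq
    rw [add_mul, skew_coeff_add, hp, hq, skew_coeff_add]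
  · intro j b
    rw [monomial_mul_X, coeff_monomial, coeff_monomial]
    simp

theorem mul_X_pow_ne_zero {p : SkewPolynomial K} (hp : p ≠ 0) (k : ℕ) : p * X ^ k ≠ 0 := by
  induction k with
  | zero => rwa [pow_zero, mul_one]
  | succ k ih =>
    rw [pow_succ, ← mul_assoc]
    intro h
    refine ih (skew_ext fun i => ?_)
    rw [← coeff_succ_mul_X, h, SkewPolynomial.coeff_zero, SkewPolynomial.coeff_zero]

theorem skew_mul_ne_zero {p q : SkewPolynomial K} (hp : p ≠ 0) (hq : q ≠ 0) : p * q ≠ 0 := by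
  obtain ⟨s, k, hs, rfl⟩ := exists_eq_sep_mul_X_pow hq
  rw [← mul_assoc]
  exact mul_X_pow_ne_zero (mul_sep_ne_zero hp hs) k

/-- The left Ore condition. -/
theorem exists_mul_eq_mul {r : SkewPolynomial K} (hr : r ≠ 0) (p : SkewPolynomial K) :
    ∃ r' s : SkewPolynomial K, r' ≠ 0 ∧ r' * p = s * r := by
  obtain ⟨d, hd⟩ := exists_hasDegree hr
  choose s t hst ht using fun i : ℕ => exists_eq_mul_add hd (monomial i 1 * p)
  -- The remainders of `X ^ i * p` modulo `r`, for `i ≤ d`, are `d + 1` vectors in a space of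
  -- dimension `d`; a linear relation gives `r'`.
  have hdep : ¬ LinearIndependent K fun (i : Fin (d + 1)) (j : Fin d) => (t i).coeff j := by
    intro h
    have := h.fintype_card_le_finrank
    simp at this
  obtain ⟨g, hg, i₀, hi₀⟩ := Fintype.not_linearIndependent_iff.1 hdep
  refine ⟨∑ i : Fin (d + 1), C (g i) * monomial i 1, ∑ i : Fin (d + 1), C (g i) * s i, ?_, ?_⟩
  · intro h
    have h1 := congrArg (fun p => coeff p (i₀ : ℕ)) h
    simp only [skew_coeff_sum, skew_coeff_C_mul, coeff_monomial, SkewPolynomial.coeff_zero,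
      mul_ite, mul_one, mul_zero, Fin.val_inj] at h1
    rw [Finset.sum_ite_eq' Finset.univ i₀ g, if_pos (Finset.mem_univ _)] at h1
    exact hi₀ h1
  · have ht0 : ∑ i : Fin (d + 1), C (g i) * t i = 0 := by
      refine skew_ext fun j => ?_
      rw [skew_coeff_sum, SkewPolynomial.coeff_zero]
      simp only [skew_coeff_C_mul]
      rcases lt_or_ge j d with hj | hj
      · have := congrFun hg ⟨j, hj⟩
        simpa using this
      · exact Finset.sum_eq_zero fun i _ => by rw [ht i j hj, mul_zero]
    rw [Finset.sum_mul, Finset.sum_mul, ← add_zero (∑ i, C (g i) * s i * r), ← ht0,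
      ← Finset.sum_add_distrib]
    refine Finset.sum_congr rfl fun i _ => ?_
    rw [mul_assoc, mul_assoc, ← mul_add, ← hst]

/-- The torsion submodule. -/
noncomputable def torsionSubmodule (K M : Type*) [Field K] [MulSemiringAction (Multiplicative ℕ) K]
    [AddCommGroup M] [Module (SkewPolynomial K) M] : Submodule (SkewPolynomial K) M where
  carrier := torsionSet K M
  zero_mem' := ⟨1, by rw [← C_1]; exact IsSep.ne_zero (by simp [IsSep]), smul_zero _⟩
  smul_mem' p m := by
    rintro ⟨r, hr, hm⟩
    obtain ⟨r', s, hr', h⟩ := exists_mul_eq_mul hr p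
    exact ⟨r', hr', by rw [smul_smul, h, mul_smul, hm, smul_zero]⟩
  add_mem' {a b} := by
    rintro ⟨r, hr, ha⟩ ⟨s, hs, hb⟩
    obtain ⟨r', t, hr', h⟩ := exists_mul_eq_mul hr s
    refine ⟨r' * s, skew_mul_ne_zero hr' hs, ?_⟩
    rw [smul_add, mul_smul r' s b, hb, smul_zero, add_zero, h, mul_smul, ha, smul_zero]

end Torsion

/-! ### Separable closures and the functions `λ_i` -/

section SepClosure

variable {K : Type*} [Field K] [MulSemiringAction (Multiplicative ℕ) K]
  {M : Type*} [AddCommGroup M] [Module (SkewPolynomial K) M]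

/-- A submodule is closed if it contains all solutions of `σ`-separable equations with right hand
side in the submodule. -/
def IsSepClosed (P : Submodule (SkewPolynomial K) M) : Prop :=
  ∀ q : SkewPolynomial K, IsSep q → ∀ m, q • m ∈ P → m ∈ P

/-- The smallest closed submodule containing a given one. -/
noncomputable def sepClosure (M₀ : Submodule (SkewPolynomial K) M) :
    Submodule (SkewPolynomial K) M :=
  sInf {Q | M₀ ≤ Q ∧ IsSepClosed Q}

theorem le_sepClosure (M₀ : Submodule (SkewPolynomial K) M) : M₀ ≤ sepClosure M₀ :=
  le_sInf fun _ hQ => hQ.1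

theorem sepClosure_le {M₀ Q : Submodule (SkewPolynomial K) M} (h : M₀ ≤ Q) (hQ : IsSepClosed Q) :
    sepClosure M₀ ≤ Q := sInf_le ⟨h, hQ⟩

theorem isSepClosed_sepClosure (M₀ : Submodule (SkewPolynomial K) M) :
    IsSepClosed (sepClosure M₀) := by
  intro q hq m hm
  refine Submodule.mem_sInf.2 fun Q hQ => hQ.2 q hq m (Submodule.mem_sInf.1 hm Q hQ)

theorem isSepClosed_torsionSubmodule : IsSepClosed (torsionSubmodule K M) := by
  rintro q hq m ⟨r, hr, h⟩
  exact ⟨r * q, mul_sep_ne_zero hr hq, by rw [mul_smul, h]⟩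

variable {n : ℕ} {Δ : Type*} {S : LV n Δ M}

section Lambda

variable {c : Fin n → K}

theorem ModelsTσ.lam_zero (h : ModelsTσ c S) (i : Fin n) : S.lam i 0 = 0 :=
  (h.unique 0 (fun _ => 0) (by simp) i).symm

/-- The submodule of the elements `∑ yᵢ · t cᵢ` with all `yᵢ` in `P`. -/
noncomputable def decomposable (c : Module.Basis (Fin n) (sig K).fieldRange K)
    (P : Submodule (SkewPolynomial K) M) : Submodule (SkewPolynomial K) M where
  carrier := {x | ∃ y : Fin n → M, (∀ i, y i ∈ P) ∧
    x = ∑ i, (monomial 1 (c i) : SkewPolynomial K) • y i}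
  zero_mem' := ⟨fun _ => 0, fun _ => P.zero_mem, by simp⟩
  add_mem' := by
    rintro _ _ ⟨y, hy, rfl⟩ ⟨z, hz, rfl⟩
    exact ⟨y + z, fun i => P.add_mem (hy i) (hz i), by simp [smul_add, Finset.sum_add_distrib]⟩
  smul_mem' := by
    have hadd : ∀ x x' : M,
        (∃ y : Fin n → M, (∀ i, y i ∈ P) ∧
          x = ∑ i, (monomial 1 (c i) : SkewPolynomial K) • y i) →
        (∃ y : Fin n → M, (∀ i, y i ∈ P) ∧
          x' = ∑ i, (monomial 1 (c i) : SkewPolynomial K) • y i) →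
        ∃ y : Fin n → M, (∀ i, y i ∈ P) ∧
          x + x' = ∑ i, (monomial 1 (c i) : SkewPolynomial K) • y i := by
      rintro _ _ ⟨y, hy, rfl⟩ ⟨z, hz, rfl⟩
      exact ⟨y + z, fun i => P.add_mem (hy i) (hz i), by simp [smul_add, Finset.sum_add_distrib]⟩
    -- Writing `b = ∑ c_i σ(a_i)` in the basis, the commutation rule moves each `a_i` to the right
    -- of one factor `X`.
    have hmon : ∀ (k : ℕ) (b : K) (y : M), y ∈ P → ∃ z : Fin n → M, (∀ i, z i ∈ P) ∧
        (monomial (1 + k) b : SkewPolynomial K) • y =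
          ∑ i, (monomial 1 (c i) : SkewPolynomial K) • z i := by
      intro k b y hy
      choose a ha using fun i : Fin n => (c.repr b i).2
      refine ⟨fun i => (monomial k (a i) : SkewPolynomial K) • y, fun i => P.smul_mem _ hy, ?_⟩
      have hb : b = ∑ i, c i * sig K (a i) := by
        conv_lhs => rw [← c.sum_repr b]
        refine Finset.sum_congr rfl fun i _ => ?_
        rw [ha i, Subfield.smul_def, smul_eq_mul, mul_comm]
      have hb' : (monomial (1 + k) b : SkewPolynomial K) =
          ∑ i, monomial 1 (c i) * monomial k (a i) := by
        simp only [monomial_mul_monomial, Function.iterate_one]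
        conv_lhs => rw [hb]
        exact map_sum (monomial (1 + k)) _ _
      rw [hb', Finset.sum_smul]
      exact Finset.sum_congr rfl fun i _ => mul_smul _ _ _
    rintro p _ ⟨y, hy, rfl⟩
    change ∃ z : Fin n → M, (∀ i, z i ∈ P) ∧
      p • (∑ i, (monomial 1 (c i) : SkewPolynomial K) • y i) =
        ∑ i, (monomial 1 (c i) : SkewPolynomial K) • z i
    rw [Finset.smul_sum]
    refine Finset.sum_induction _ (fun x => ∃ z : Fin n → M, (∀ i, z i ∈ P) ∧
      x = ∑ i, (monomial 1 (c i) : SkewPolynomial K) • z i) hadd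
      ⟨fun _ => 0, fun _ => P.zero_mem, by simp⟩ fun i _ => ?_
    refine skew_induction (P := fun p => ∃ z : Fin n → M, (∀ i, z i ∈ P) ∧
      p • (monomial 1 (c i) : SkewPolynomial K) • y i =
        ∑ i, (monomial 1 (c i) : SkewPolynomial K) • z i) ?_ ?_ p
    · intro p q hp hq
      simp only [add_smul]
      exact hadd _ _ hp hq
    · intro k b
      rw [smul_smul, monomial_mul_monomial, add_comm k 1]
      exact hmon _ _ _ (hy i)

theorem decomposable_le (c : Module.Basis (Fin n) (sig K).fieldRange K)
    (P : Submodule (SkewPolynomial K) M) : decomposable c P ≤ P := by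
  rintro _ ⟨y, hy, rfl⟩
  exact P.sum_mem fun i _ => P.smul_mem _ (hy i)

theorem X_smul_mem_decomposable [NeZero n] (c : Module.Basis (Fin n) (sig K).fieldRange K)
    (h_one : c 0 = 1) {P : Submodule (SkewPolynomial K) M} {m : M} (hm : m ∈ P) :
    (X : SkewPolynomial K) • m ∈ decomposable c P := by
  refine ⟨Pi.single 0 m, fun i => ?_, ?_⟩
  · by_cases h : i = 0
    · subst h; simpa using hm
    · simp [h]
  · rw [Finset.sum_eq_single 0]
    · rw [h_one, Pi.single_eq_same, monomial_one_one_eq_X]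
    · intro i _ hi
      rw [Pi.single_eq_of_ne hi, smul_zero]
    · exact fun h => absurd (Finset.mem_univ _) h

/-- The decomposable elements form a separably closed submodule containing `M₀`: in `q • m` the
terms of positive degree are decomposable because `X • m` is, so `q_0 • m`, and hence `m`, is too.
-/
theorem sepClosure_le_decomposable [NeZero n] (c : Module.Basis (Fin n) (sig K).fieldRange K)
    (h_one : c 0 = 1) (h : ModelsTσ c S) (M₀ : LVSub K S) :
    sepClosure M₀.toSubmodule ≤ decomposable c (sepClosure M₀.toSubmodule) := by
  refine sepClosure_le (fun x hx => ?_) ?_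
  · exact ⟨fun i => S.lam i x, fun i => le_sepClosure _ (M₀.lam_mem i x hx), h.eq_sum x⟩
  · intro q hq m hm
    have hmP : m ∈ sepClosure M₀.toSubmodule :=
      isSepClosed_sepClosure _ q hq m (decomposable_le c _ hm)
    obtain ⟨N, hN⟩ := exists_coeff_bound q
    rw [IsHenselian.smul_eq_sum (n := N + 1) (fun i hi => hN i (by omega)),
      Finset.sum_range_succ'] at hm
    have h1 : ∑ i ∈ Finset.range N, (monomial (i + 1) (q.coeff (i + 1)) : SkewPolynomial K) • m ∈
        decomposable c (sepClosure M₀.toSubmodule) := by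
      refine Submodule.sum_mem _ fun i _ => ?_
      rw [← monomial_mul_X, mul_smul]
      exact Submodule.smul_mem _ _ (X_smul_mem_decomposable c h_one hmP)
    have h2 := Submodule.smul_mem _ (C (q.coeff 0)⁻¹) ((Submodule.add_mem_iff_right _ h1).1 hm)
    rwa [monomial_zero_left, IsHenselian.C_inv_smul_smul hq] at h2

theorem lam_mem_sepClosure [NeZero n] (c : Module.Basis (Fin n) (sig K).fieldRange K)
    (h_one : c 0 = 1) (h : ModelsTσ c S) (M₀ : LVSub K S) (i : Fin n) {x : M}
    (hx : x ∈ sepClosure M₀.toSubmodule) : S.lam i x ∈ sepClosure M₀.toSubmodule := by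
  obtain ⟨y, hy, hxy⟩ := sepClosure_le_decomposable c h_one h M₀ hx
  rw [← h.unique x y hxy i]
  exact hy i

/-- The closure of a substructure. -/
noncomputable def sepClosureSub [NeZero n] (c : Module.Basis (Fin n) (sig K).fieldRange K)
    (h_one : c 0 = 1) (h : ModelsTσ c S) (M₀ : LVSub K S) : LVSub K S where
  toSubmodule := sepClosure M₀.toSubmodule
  lam_mem i _ hx := lam_mem_sepClosure c h_one h M₀ i hx

/-- Since `c 0 = 1`, uniqueness of the decomposition gives `λ_0 (X • m) = m`. -/
theorem mem_of_X_smul_mem [NeZero n] {c : Fin n → K} (h_one : c 0 = 1) (h : ModelsTσ c S)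
    (P : LVSub K S) {m : M} (hm : (X : SkewPolynomial K) • m ∈ P.toSubmodule) :
    m ∈ P.toSubmodule := by
  have h1 := h.unique ((X : SkewPolynomial K) • m) (Pi.single 0 m) (by
    rw [Finset.sum_eq_single 0]
    · rw [h_one, Pi.single_eq_same, monomial_one_one_eq_X]
    · intro i _ hi
      rw [Pi.single_eq_of_ne hi, smul_zero]
    · exact fun h => absurd (Finset.mem_univ _) h) 0
  rw [Pi.single_eq_same] at h1
  rw [h1]
  exact P.lam_mem 0 _ hm

/-- The zero substructure. -/
noncomputable def botSub {c : Fin n → K} (h : ModelsTσ c S) : LVSub K S where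
  toSubmodule := ⊥
  lam_mem i x hx := by
    rw [Submodule.mem_bot] at hx ⊢
    rw [hx, h.lam_zero]

/-- An annihilating polynomial factors as `q * X ^ k` with `q` separable: closedness removes `q`,
and `λ_0` removes the powers of `X`. -/
theorem sepClosure_bot_eq_torsionSubmodule [NeZero n]
    (c : Module.Basis (Fin n) (sig K).fieldRange K) (h_one : c 0 = 1) (h : ModelsTσ c S) :
    sepClosure (⊥ : Submodule (SkewPolynomial K) M) = torsionSubmodule K M := by
  refine le_antisymm (sepClosure_le bot_le isSepClosed_torsionSubmodule) ?_
  rintro m ⟨r, hr, hm⟩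
  obtain ⟨q, k, hq, rfl⟩ := exists_eq_sep_mul_X_pow hr
  rw [mul_smul] at hm
  have hX : ∀ k : ℕ, (X ^ k : SkewPolynomial K) • m ∈
      sepClosure (⊥ : Submodule (SkewPolynomial K) M) →
      m ∈ sepClosure (⊥ : Submodule (SkewPolynomial K) M) := by
    intro k
    induction k with
    | zero => exact fun h1 => by simpa using h1
    | succ k ih =>
      intro h1
      rw [pow_succ', mul_smul] at h1
      exact ih (mem_of_X_smul_mem h_one h (sepClosureSub c h_one h (botSub h)) h1)
  exact hX k (isSepClosed_sepClosure _ q hq _ (hm ▸ zero_mem _))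

end Lambda

end SepClosure

/-! ### Submodels are the separably closed substructures -/

section Models

variable {K Γ : Type*} [Field K] [MulSemiringAction (Multiplicative ℕ) K]
  [AddCommGroup Γ] [LinearOrder Γ] [IsOrderedAddMonoid Γ] {𝓥 : ContractiveValuation K Γ}
  {Δ : Type*} [LinearOrder Δ] [AddAction Γ Δ]
  {M : Type*} [AddCommGroup M] [Module (SkewPolynomial K) M] {n : ℕ}
  {D : Chain 𝓥 Δ} {c : Fin n → K} {S : LV n Δ M}

theorem Chain.strictMono (D : Chain 𝓥 Δ) : StrictMono fun γ : Γ => γ +ᵥ D.zero :=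
  fun _ _ h => D.vadd_lt _ _ _ h

theorem Chain.τ_val_vadd_zero (D : Chain 𝓥 Δ) (a : Kˣ) :
    D.τ (𝓥.val a +ᵥ D.zero) = 𝓥.val (ContractiveValuation.sigU K a) +ᵥ D.zero := by
  rw [D.τ_vadd, D.τ_zero, 𝓥.sigv_val]

/-- As `τ` fixes `0_Δ`, it corresponds to `σ_v` under `γ ↦ γ +ᵥ 0_Δ`, so surjectivity passes from
`τ` to `σ_v`. -/
theorem Chain.exists_v_sig_eq (D : Chain 𝓥 Δ) (h_surj : Function.Surjective D.τ) (b : K)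
    (hb : b ≠ 0) : ∃ a, 𝓥.v (sig K a) = 𝓥.v b := by
  obtain ⟨δ, hδ⟩ := h_surj (𝓥.val (Units.mk0 b hb) +ᵥ D.zero)
  obtain ⟨γ, rfl⟩ := D.transitive D.zero δ
  obtain ⟨a, rfl⟩ := 𝓥.val_surjective γ
  rw [D.τ_val_vadd_zero] at hδ
  have h := D.strictMono.injective hδ
  refine ⟨a, ?_⟩
  have h2 := 𝓥.coe_val (ContractiveValuation.sigU K a)
  rw [h, 𝓥.coe_val] at h2
  exact h2.symm

/-- In a model, the values can be taken in `Γ`, which is in bijection with `Δ`. -/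
theorem IsModel.exists_isHenselian (hS : IsModel D c S) :
    ∃ u : M → WithTop Γ, IsHenselian 𝓥 u ∧
      ∀ (γ : Γ) (m : M), m ∈ S.V (γ +ᵥ D.zero) ↔ (γ : WithTop Γ) ≤ u m := by
  obtain ⟨w, hw, hV⟩ := hS.valued
  choose ε hε using fun δ : Δ => D.transitive D.zero δ
  set E : WithTop Γ → WithTop Δ := WithTop.map fun γ : Γ => γ +ᵥ D.zero with hE
  have hEm : StrictMono E := D.strictMono.withTop_map
  set u : M → WithTop Γ := fun m => (w m).map ε with hu
  have hEu : ∀ m, E (u m) = w m := by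
    intro m
    simp only [hE, hu]
    cases w m with
    | top => rfl
    | coe δ =>
      rw [WithTop.map_coe, WithTop.map_coe]
      exact congrArg _ (hε δ)
  have htop : ∀ m, u m = ⊤ ↔ m = 0 := by
    intro m
    rw [← hw.eq_top, ← hEu]
    constructor
    · intro h; rw [h]; rfl
    · intro h; exact hEm.injective (h.trans rfl)
  have hval : ∀ (m : M) (a : Kˣ), u m = 𝓥.v (a : K) → w m = ((𝓥.val a +ᵥ D.zero : Δ) : WithTop Δ) := by
    intro m a h
    rw [← hEu, h, ← 𝓥.coe_val]
    rfl
  have hu_of : ∀ (m : M) (γ : Γ), w m = ((γ +ᵥ D.zero : Δ) : WithTop Δ) → u m = γ := by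
    intro m γ h
    exact hEm.injective ((hEu m).trans h)
  have hmem : ∀ (γ : Γ) (m : M), m ∈ S.V (γ +ᵥ D.zero) ↔ (γ : WithTop Γ) ≤ u m := by
    intro γ m
    rw [hV]
    change ((γ +ᵥ D.zero : Δ) : WithTop Δ) ≤ w m ↔ _
    rw [← hEu]
    exact hEm.le_iff_le (a := (γ : WithTop Γ))
  have hmem0 : ∀ m, m ∈ S.V D.zero ↔ 0 ≤ u m := by
    intro m
    have := hmem 0 m
    rwa [zero_vadd] at this
  refine ⟨u, ⟨fun x y => ?_, htop, fun a x => ?_, fun a x h => ?_, fun q hq hs x hx => ?_, hS.tor⟩,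
    hmem⟩
  · rw [← hEm.le_iff_le, hEm.monotone.map_min, hEu, hEu, hEu]
    exact hw.min_le x y
  · by_cases ha : a = 0
    · subst ha
      rw [C_0, zero_smul, AddValuation.map_zero, top_add]
      exact (htop 0).2 rfl
    by_cases hx : x = 0
    · subst hx
      rw [smul_zero, (htop 0).2 rfl, add_top]
    have h1 := hw.smul x (Units.mk0 a ha) hx
    obtain ⟨γ, hγ⟩ := WithTop.ne_top_iff_exists.1 fun h => hx ((htop x).1 h)
    rw [← hEu x, ← hγ] at h1
    have h2 := hu_of _ (𝓥.val (Units.mk0 a ha) + γ) (by rw [add_vadd]; exact h1)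
    rw [Units.val_mk0] at h2
    rw [h2, WithTop.coe_add, 𝓥.coe_val, hγ, Units.val_mk0]
  · by_cases ha : a = 0
    · subst ha
      rw [AddValuation.map_zero, htop] at h
      subst h
      rw [smul_zero, _root_.map_zero, AddValuation.map_zero]
      exact (htop 0).2 rfl
    have h1 := hw.map_t x
    rw [hval x (Units.mk0 a ha) h, WithTop.map_coe, D.τ_val_vadd_zero] at h1
    rw [hu_of _ _ h1, 𝓥.coe_val]
    rfl
  · obtain ⟨m, hm, hqm⟩ := hS.div q hq hs x ((hmem0 x).2 hx)
    exact ⟨m, (hmem0 m).1 hm, hqm⟩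

/-- The submodel has one solution by divisibility. Its annihilator of `q` has the same finite
cardinality as that in `M`, so it contains the difference between any two solutions. -/
theorem isSepClosed_of_isModel_induced (hS : IsModel D c S)
    (h_fix : {a : K | sig K a = a}.Finite) (h_surj : Function.Surjective D.τ) (Q : LVSub K S)
    (hQ : IsModel D c Q.induced) : IsSepClosed Q.toSubmodule := by
  obtain ⟨u, hu, -⟩ := hS.exists_isHenselian
  obtain ⟨w, hw, -⟩ := hQ.exists_isHenselian
  intro q hq m hm
  obtain ⟨z, hz⟩ := hw.exists_smul_eq (D.exists_v_sig_eq h_surj) hq ⟨q • m, hm⟩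
  obtain ⟨d, hd⟩ := exists_hasDegree hq.ne_zero
  obtain ⟨hf, hcard⟩ := hu.card_annihilator h_fix hq hd
  obtain ⟨hf', hcard'⟩ := hw.card_annihilator h_fix hq hd
  have hsub : Subtype.val '' {x : Q.toSubmodule | q • x = 0} ⊆ {x : M | q • x = 0} := by
    rintro _ ⟨x, hx, rfl⟩
    exact congrArg Subtype.val hx
  have heq := Set.eq_of_subset_of_ncard_le hsub
    (by rw [Set.ncard_image_of_injective _ Subtype.val_injective, hcard, hcard']) hf
  have hmz : m - z ∈ {x : M | q • x = 0} := by
    change q • (m - (z : M)) = 0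
    have hz' : q • (z : M) = q • m := congrArg Subtype.val hz
    rw [smul_sub, hz', sub_self]
  rw [← heq] at hmz
  obtain ⟨x, -, hx⟩ := hmz
  have := Q.toSubmodule.add_mem x.2 z.2
  rwa [hx, sub_add_cancel] at this

theorem fixIndep_coe {P : Submodule (SkewPolynomial K) M} {d : ℕ} (x : Fin d → P) :
    FixIndep K (fun i => (x i : M)) ↔ FixIndep K x := by
  refine forall_congr' fun a => forall_congr' fun _ => ?_
  have : (∑ i, (C (a i) : SkewPolynomial K) • (x i : M) = 0) ↔
      ∑ i, (C (a i) : SkewPolynomial K) • x i = 0 := by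
    rw [← Submodule.coe_eq_zero]
    simp
  rw [this]

theorem modelsTσ_induced (h : ModelsTσ c S) (P : LVSub K S) : ModelsTσ c P.induced where
  eq_sum x := Subtype.ext (by simpa [LVSub.induced] using h.eq_sum (x : M))
  unique x y hxy i := Subtype.ext (h.unique (x : M) (fun i => (y i : M)) (by
    have := congrArg Subtype.val hxy
    simpa using this) i)

theorem isModel_induced_of_isSepClosed (hS : IsModel D c S) (P : LVSub K S)
    (hP : IsSepClosed P.toSubmodule) : IsModel D c P.induced := by
  have hmem0 : ∀ (q : SkewPolynomial K) (m : M), IsSep q → q • m = 0 → m ∈ P.toSubmodule :=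
    fun q m hq hm => hP q hq m (hm ▸ zero_mem _)
  refine ⟨?_, ⟨modelsTσ_induced hS.tV.tσ P, fun δ₁ δ₂ m => hS.tV.anti δ₁ δ₂ m,
    fun δ m₁ m₂ => hS.tV.add δ m₁ m₂, fun δ m μ => hS.tV.smul δ m μ,
    fun δ m => hS.tV.t_iff δ m⟩, ?_, ?_⟩
  · obtain ⟨w, hw, hV⟩ := hS.valued
    refine ⟨fun x => w x, ⟨fun x y => hw.min_le x y, fun x => ?_, fun x y => hw.lt_iff x y,
      fun x μ hx => hw.smul x μ fun h => hx (Subtype.ext h), ?_, fun x => hw.map_t x⟩, fun δ => ?_⟩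
    · rw [hw.eq_top]
      exact Submodule.coe_eq_zero
    -- Surjectivity of the valuation needs just one nonzero element of the substructure, as
    -- constants move its value anywhere. One annihilated by `X + 1` exists by the torsion axiom and
    -- lies in `P` by closedness.
    · have hq1 : ∀ i, (monomial 1 1 + C 1 : SkewPolynomial K).coeff i =
          (if 1 = i then 1 else 0) + (if i = 0 then 1 else 0) := by
        intro i
        rw [skew_coeff_add, coeff_monomial, coeff_C]
      have hsep : IsSep (monomial 1 1 + C 1 : SkewPolynomial K) := by
        rw [IsSep, hq1]; simp
      obtain ⟨x, hx, hxi⟩ := (hS.tor (monomial 1 1 + C 1) 1 (by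
          refine ⟨fun i => ?_, 0, ?_⟩
          · rw [hq1]
            split_ifs with h1 h2
            · omega
            · rw [add_zero, 𝓥.v_one]
            · rw [zero_add, 𝓥.v_one]
            · rw [add_zero, AddValuation.map_zero]; exact le_top
          · rw [hq1]
            simp) hsep ⟨by rw [hq1]; simp, fun j hj => by
              rw [hq1, if_neg (by omega), if_neg (by omega), add_zero]⟩).1
      have hx0 : x 0 ≠ 0 := by
        intro h0
        exact one_ne_zero (hxi (fun _ => 1) (fun _ => map_one _) (by simp [h0]) 0)
      obtain ⟨δ₀, hδ₀⟩ := WithTop.ne_top_iff_exists.1 fun h => hx0 ((hw.eq_top (x 0)).1 h)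
      intro δ
      cases δ with
      | top => exact ⟨0, (hw.eq_top _).2 rfl⟩
      | coe δ =>
        obtain ⟨γ, hγ⟩ := D.transitive δ₀ δ
        obtain ⟨μ, rfl⟩ := 𝓥.val_surjective γ
        refine ⟨⟨(C (μ : K) : SkewPolynomial K) • x 0,
          P.toSubmodule.smul_mem _ (hmem0 _ _ hsep (hx 0))⟩, ?_⟩
        change w ((C (μ : K) : SkewPolynomial K) • x 0) = _
        rw [hw.smul _ _ hx0, ← hδ₀, WithTop.map_coe, hγ]
    · ext x
      change (x : M) ∈ S.V δ ↔ _
      rw [hV]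
      rfl
  · intro q hq hs x hx
    obtain ⟨m, hm, hqm⟩ := hS.div q hq hs (x : M) hx
    exact ⟨⟨m, hP q hs m (hqm ▸ x.2)⟩, hm, Subtype.ext hqm⟩
  · intro q d hq hs hd
    obtain ⟨⟨x, hx, hxi⟩, h2⟩ := hS.tor q d hq hs hd
    refine ⟨⟨fun i => ⟨x i, hmem0 q _ hs (hx i)⟩, fun i => Subtype.ext (hx i), ?_⟩, ?_⟩
    · rw [← fixIndep_coe]
      exact hxi
    · rintro ⟨y, hy, hyi⟩
      exact h2 ⟨fun i => (y i : M), fun i => congrArg Subtype.val (hy i), (fixIndep_coe y).2 hyi⟩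

theorem isMinimalSubmodel_sepClosureSub [NeZero n] (hS : IsModel D c S)
    (h_fix : {a : K | sig K a = a}.Finite) (h_surj : Function.Surjective D.τ)
    {M₀ P : LVSub K S} (hP : P.toSubmodule = sepClosure M₀.toSubmodule) :
    IsMinimalSubmodel D c M₀ P := by
  refine ⟨⟨hP ▸ le_sepClosure _, isModel_induced_of_isSepClosed hS P
    (hP ▸ isSepClosed_sepClosure _)⟩, fun Q hQ hQm => ?_⟩
  rw [hP]
  exact sepClosure_le hQ (isSepClosed_of_isModel_induced hS h_fix h_surj Q hQm)

end Models

/-! ### Extending isomorphisms to separable closures -/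

section Extension

variable {K Γ : Type*} [Field K] [MulSemiringAction (Multiplicative ℕ) K]
  [AddCommGroup Γ] [LinearOrder Γ] [IsOrderedAddMonoid Γ] {𝓥 : ContractiveValuation K Γ}
  {M N : Type*} [AddCommGroup M] [Module (SkewPolynomial K) M]
  [AddCommGroup N] [Module (SkewPolynomial K) N]
  {u : M → WithTop Γ} {u' : N → WithTop Γ} {G₀ : Submodule (SkewPolynomial K) (M × N)}

/-- A partial isometry extends to an isometry of the closures of its domain and its range. -/
theorem IsPartialIsometry.exists_extension_sepClosure (hM : IsHenselian 𝓥 u)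
    (hN : IsHenselian 𝓥 u') (h_fix : {a : K | sig K a = a}.Finite)
    (hσ : ∀ b : K, b ≠ 0 → ∃ a, 𝓥.v (sig K a) = 𝓥.v b) (hG₀ : IsPartialIsometry u u' G₀) :
    ∃ G, IsPartialIsometry u u' G ∧ G₀ ≤ G ∧ relDom G = sepClosure (relDom G₀) ∧
      relDom (relSwap G) = sepClosure (relDom (relSwap G₀)) := by
  set B : Submodule (SkewPolynomial K) (M × N) :=
    (sepClosure (relDom G₀)).prod (sepClosure (relDom (relSwap G₀))) with hB
  -- Zorn's lemma is confined to `B`, so that the domain and range of a maximal relation cannot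
  -- exceed the two closures. One-step extensions stay in `B`, since they adjoin solutions of
  -- separable equations.
  obtain ⟨G, hle, hmax⟩ := zorn_le_nonempty₀ {G | IsPartialIsometry u u' G ∧ G ≤ B}
    (by
      intro ch hch hchain G₁ hG₁
      refine ⟨sSup ch, ⟨fun x y hxy => ?_, sSup_le fun G hG => (hch hG).2⟩, fun G hG => le_sSup hG⟩
      obtain ⟨G, hG, hxyG⟩ :=
        (Submodule.mem_sSup_of_directed ⟨G₁, hG₁⟩ hchain.directedOn).1 hxy
      exact (hch hG).1 x y hxyG)
    G₀ ⟨hG₀, fun z hz => ⟨le_sepClosure _ (mem_relDom.2 ⟨z.2, hz⟩),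
      le_sepClosure _ (mem_relDom_relSwap.2 ⟨z.1, hz⟩)⟩⟩
  obtain ⟨hG, hGB⟩ := hmax.prop
  have hcl : IsSepClosed (relDom G) := by
    intro q hq m hqm
    by_contra hm
    obtain ⟨p, x, y, hp, hx, hpxy, hext⟩ :=
      hG.exists_extension hM hN h_fix hσ ⟨q, hq, m, hm, hqm⟩
    have hle' := hmax.le_of_ge (y := G ⊔ Submodule.span (SkewPolynomial K) {(x, y)})
      ⟨hext, sup_le hGB ((Submodule.span_singleton_le_iff_mem _ _).2
        ⟨isSepClosed_sepClosure _ p hp x (hGB hpxy).1,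
          isSepClosed_sepClosure _ p hp y (hGB hpxy).2⟩)⟩ le_sup_left
    exact hx (mem_relDom.2 ⟨y, hle' (Submodule.mem_sup_right
      (Submodule.mem_span_singleton_self _))⟩)
  have hcl' : IsSepClosed (relDom (relSwap G)) := by
    intro q hq
    obtain ⟨d, hd⟩ := exists_coeff_bound q
    exact hG.isSepClosedBelow_swap hM hN h_fix hσ (d := d) (fun p hp _ => hcl p hp) q hq hd
  refine ⟨G, hG, hle, le_antisymm ?_ (sepClosure_le ?_ hcl), le_antisymm ?_ (sepClosure_le ?_ hcl')⟩
  · intro x hx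
    obtain ⟨y, hxy⟩ := mem_relDom.1 hx
    exact (hGB hxy).1
  · intro x hx
    obtain ⟨y, hxy⟩ := mem_relDom.1 hx
    exact mem_relDom.2 ⟨y, hle hxy⟩
  · intro y hy
    obtain ⟨x, hxy⟩ := mem_relDom_relSwap.1 hy
    exact (hGB hxy).2
  · intro y hy
    obtain ⟨x, hxy⟩ := mem_relDom_relSwap.1 hy
    exact mem_relDom_relSwap.2 ⟨x, hle hxy⟩

/-- The isomorphism whose graph is a given partial isometry. -/
theorem IsPartialIsometry.exists_linearEquiv (hM : IsHenselian 𝓥 u) (hN : IsHenselian 𝓥 u')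
    {G : Submodule (SkewPolynomial K) (M × N)} (hG : IsPartialIsometry u u' G)
    {P : Submodule (SkewPolynomial K) M} {P' : Submodule (SkewPolynomial K) N}
    (hP : relDom G = P) (hP' : relDom (relSwap G) = P') :
    ∃ e : P ≃ₗ[SkewPolynomial K] P', ∀ x : P, ((x : M), (e x : N)) ∈ G := by
  let f₁ : G →ₗ[SkewPolynomial K] P :=
    ((LinearMap.fst (SkewPolynomial K) M N).comp G.subtype).codRestrict P fun z =>
      hP ▸ mem_relDom.2 ⟨z.1.2, z.2⟩
  let f₂ : G →ₗ[SkewPolynomial K] P' :=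
    ((LinearMap.snd (SkewPolynomial K) M N).comp G.subtype).codRestrict P' fun z =>
      hP' ▸ mem_relDom_relSwap.2 ⟨z.1.1, z.2⟩
  have h₁ : Function.Bijective f₁ := by
    constructor
    · rintro ⟨⟨x, y⟩, h⟩ ⟨⟨x', y'⟩, h'⟩ heq
      have hx : x = x' := congrArg Subtype.val heq
      subst hx
      have hy : y = y' := hG.right_unique hM hN h h'
      subst hy
      rfl
    · rintro ⟨x, hx⟩
      obtain ⟨y, hy⟩ := mem_relDom.1 (hP.symm ▸ hx)
      exact ⟨⟨(x, y), hy⟩, rfl⟩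
  have h₂ : Function.Bijective f₂ := by
    constructor
    · rintro ⟨⟨x, y⟩, h⟩ ⟨⟨x', y'⟩, h'⟩ heq
      have hy : y = y' := congrArg Subtype.val heq
      subst hy
      have hx : x = x' := hG.left_unique hM hN h h'
      subst hx
      rfl
    · rintro ⟨y, hy⟩
      obtain ⟨x, hx⟩ := mem_relDom_relSwap.1 (hP'.symm ▸ hy)
      exact ⟨⟨(x, y), hx⟩, rfl⟩
  refine ⟨(LinearEquiv.ofBijective f₁ h₁).symm.trans (LinearEquiv.ofBijective f₂ h₂), fun x => ?_⟩
  obtain ⟨z, rfl⟩ := h₁.2 x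
  have : (LinearEquiv.ofBijective f₁ h₁).symm (f₁ z) = z :=
    (LinearEquiv.ofBijective f₁ h₁).symm_apply_apply z
  rw [LinearEquiv.trans_apply, this]
  exact z.2

/-- Uniqueness of the decomposition makes the `λ_i` definable from the module structure. -/
theorem linearEquiv_map_lam {n : ℕ} {Δ : Type*} {c : Fin n → K} {S : LV n Δ M} {S' : LV n Δ N}
    (h : ModelsTσ c S) (h' : ModelsTσ c S') (e : M ≃ₗ[SkewPolynomial K] N) (i : Fin n) (x : M) :
    e (S.lam i x) = S'.lam i (e x) := by
  refine h'.unique (e x) (fun i => e (S.lam i x)) ?_ i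
  conv_lhs => rw [h.eq_sum x, map_sum]
  simp only [map_smul]

/-- Isomorphic substructures of models have isomorphic closures. -/
theorem exists_iso_sepClosure {Δ : Type*} [LinearOrder Δ] [AddAction Γ Δ] {n : ℕ}
    {D : Chain 𝓥 Δ} {c : Fin n → K} {S : LV n Δ M} {S' : LV n Δ N}
    (h_fix : {a : K | sig K a = a}.Finite) (h_surj : Function.Surjective D.τ)
    (hS : IsModel D c S) (hS' : IsModel D c S') {M₀ P : LVSub K S} {N₀ P' : LVSub K S'}
    (f : LVIso K M₀.induced N₀.induced) (hP : P.toSubmodule = sepClosure M₀.toSubmodule)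
    (hP' : P'.toSubmodule = sepClosure N₀.toSubmodule) :
    ∃ g : LVIso K P.induced P'.induced,
      ∀ (x : M₀.toSubmodule) (y : P.toSubmodule), (x : M) = (y : M) →
        (f.toEquiv x : N) = (g.toEquiv y : N) := by
  obtain ⟨u, hu, hV⟩ := hS.exists_isHenselian
  obtain ⟨u', hu', hV'⟩ := hS'.exists_isHenselian
  let G₀ : Submodule (SkewPolynomial K) (M × N) := LinearMap.range
    (M₀.toSubmodule.subtype.prod (N₀.toSubmodule.subtype.comp f.toEquiv.toLinearMap))
  have hG₀mem : ∀ x : M₀.toSubmodule, ((x : M), (f.toEquiv x : N)) ∈ G₀ := fun x => ⟨x, rfl⟩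
  have hG₀ : IsPartialIsometry u u' G₀ := by
    rintro _ _ ⟨x, hx⟩
    obtain ⟨rfl, rfl⟩ := Prod.mk.inj hx
    change u (x : M) = u' (f.toEquiv x : N)
    by_cases h0 : x = 0
    · subst h0
      rw [map_zero, Submodule.coe_zero, Submodule.coe_zero, hu.map_zero, hu'.map_zero]
    have h1 : (x : M) ≠ 0 := fun h => h0 (Subtype.ext h)
    have h2 : (f.toEquiv x : N) ≠ 0 := fun h =>
      h0 ((LinearEquiv.map_eq_zero_iff f.toEquiv).1 (Subtype.ext h))
    obtain ⟨α, hα⟩ := WithTop.ne_top_iff_exists.1 fun h => h1 ((hu.eq_top _).1 h)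
    obtain ⟨β, hβ⟩ := WithTop.ne_top_iff_exists.1 fun h => h2 ((hu'.eq_top _).1 h)
    -- The predicates only test values against elements of `Γ`; both values being finite, testing
    -- each against the other gives equality.
    have key : ∀ γ : Γ, (γ : WithTop Γ) ≤ u (x : M) ↔ (γ : WithTop Γ) ≤ u' (f.toEquiv x : N) := by
      intro γ
      rw [← hV, ← hV']
      exact f.mem_V _ x
    refine le_antisymm ?_ ?_
    · rw [← hα]
      exact (key α).1 hα.le
    · rw [← hβ]
      exact (key β).2 hβ.le
  have hdom : relDom G₀ = M₀.toSubmodule := by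
    ext x
    rw [mem_relDom]
    constructor
    · rintro ⟨y, z, hz⟩
      exact (Prod.mk.inj hz).1 ▸ z.2
    · exact fun hx => ⟨_, hG₀mem ⟨x, hx⟩⟩
  have hran : relDom (relSwap G₀) = N₀.toSubmodule := by
    ext y
    rw [mem_relDom_relSwap]
    constructor
    · rintro ⟨x, z, hz⟩
      exact (Prod.mk.inj hz).2 ▸ (f.toEquiv z).2
    · intro hy
      refine ⟨f.toEquiv.symm ⟨y, hy⟩, ?_⟩
      have := hG₀mem (f.toEquiv.symm ⟨y, hy⟩)
      rwa [LinearEquiv.apply_symm_apply] at this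
  obtain ⟨G, hG, hle, hd, hr⟩ :=
    hG₀.exists_extension_sepClosure hu hu' h_fix (D.exists_v_sig_eq h_surj)
  rw [hdom, ← hP] at hd
  rw [hran, ← hP'] at hr
  obtain ⟨e, he⟩ := hG.exists_linearEquiv hu hu' hd hr
  refine ⟨⟨e, linearEquiv_map_lam (modelsTσ_induced hS.tV.tσ P) (modelsTσ_induced hS'.tV.tσ P') e,
    fun δ x => ?_⟩, fun x y hxy => ?_⟩
  · obtain ⟨γ, rfl⟩ := D.transitive D.zero δ
    change (x : M) ∈ S.V _ ↔ (e x : N) ∈ S'.V _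
    rw [hV, hV', hG _ _ (he x)]
  · refine hG.right_unique hu hu' (hle (hG₀mem x)) ?_
    rw [hxy]
    exact he y

end Extension

end OreModule

/-! ### The main theorem -/

open OreModule in
theorem corollary7p5 {K Γ Δ M N : Type*}
    [Field K] [MulSemiringAction (Multiplicative ℕ) K]
    [AddCommGroup Γ] [LinearOrder Γ] [IsOrderedAddMonoid Γ]
    [LinearOrder Δ] [AddAction Γ Δ]
    [AddCommGroup M] [Module (SkewPolynomial K) M]
    [AddCommGroup N] [Module (SkewPolynomial K) N]
    (𝓥 : ContractiveValuation K Γ) (h_two : 𝓥.TwoContracting)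
    (h_fix : {a : K | sig K a = a}.Finite)
    {n : ℕ} [NeZero n] (c : Module.Basis (Fin n) (sig K).fieldRange K) (h_one : c 0 = 1)
    (D : Chain 𝓥 Δ) (h_surj : Function.Surjective D.τ)
    (S : LV n Δ M) (S' : LV n Δ N) (hM : IsModel D c S) (hN : IsModel D c S') :
    (∀ (M₀ : LVSub K S) (N₀ : LVSub K S') (f : LVIso K M₀.induced N₀.induced),
      ∃ (P : LVSub K S) (P' : LVSub K S') (g : LVIso K P.induced P'.induced),
        IsMinimalSubmodel D c M₀ P ∧ IsMinimalSubmodel D c N₀ P' ∧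
        ∀ (x : M₀.toSubmodule) (y : P.toSubmodule), (x : M) = (y : M) →
          (f.toEquiv x : N) = (g.toEquiv y : N)) ∧
    (∃ (P : LVSub K S) (P' : LVSub K S'),
      (P.toSubmodule : Set M) = torsionSet K M ∧ (P'.toSubmodule : Set N) = torsionSet K N ∧
      Nonempty (LVIso K P.induced P'.induced)) := by
  have hex : ∀ (M₀ : LVSub K S) (N₀ : LVSub K S') (f : LVIso K M₀.induced N₀.induced),
      ∃ (P : LVSub K S) (P' : LVSub K S') (g : LVIso K P.induced P'.induced),
        P.toSubmodule = sepClosure M₀.toSubmodule ∧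
        P'.toSubmodule = sepClosure N₀.toSubmodule ∧
        ∀ (x : M₀.toSubmodule) (y : P.toSubmodule), (x : M) = (y : M) →
          (f.toEquiv x : N) = (g.toEquiv y : N) := by
    intro M₀ N₀ f
    obtain ⟨g, hg⟩ := exists_iso_sepClosure h_fix h_surj hM hN f
      (P := sepClosureSub c h_one hM.tV.tσ M₀) (P' := sepClosureSub c h_one hN.tV.tσ N₀) rfl rfl
    exact ⟨_, _, g, rfl, rfl, hg⟩
  refine ⟨fun M₀ N₀ f => ?_, ?_⟩
  · obtain ⟨P, P', g, hP, hP', hg⟩ := hex M₀ N₀ f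
    exact ⟨P, P', g, isMinimalSubmodel_sepClosureSub hM h_fix h_surj hP,
      isMinimalSubmodel_sepClosureSub hN h_fix h_surj hP', hg⟩
  · have h1 : Subsingleton (botSub hM.tV.tσ).toSubmodule :=
      inferInstanceAs (Subsingleton (⊥ : Submodule (SkewPolynomial K) M))
    have h2 : Subsingleton (botSub hN.tV.tσ).toSubmodule :=
      inferInstanceAs (Subsingleton (⊥ : Submodule (SkewPolynomial K) N))
    obtain ⟨u, hu, hV⟩ := hM.exists_isHenselian
    obtain ⟨u', hu', hV'⟩ := hN.exists_isHenselian
    -- Torsion is the closure of the zero substructure, so the second claim follows by extending the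
    -- isomorphism between zero substructures.
    let f : LVIso K (botSub hM.tV.tσ).induced (botSub hN.tV.tσ).induced :=
      { toEquiv := 0
        map_lam := fun _ _ => Subsingleton.elim _ _
        mem_V := fun δ x => by
          obtain ⟨γ, rfl⟩ := D.transitive D.zero δ
          rw [Subsingleton.elim x 0, map_zero]
          change (0 : M) ∈ S.V _ ↔ (0 : N) ∈ S'.V _
          rw [hV, hV', hu.map_zero, hu'.map_zero] }
    obtain ⟨P, P', g, hP, hP', -⟩ := hex _ _ f
    refine ⟨P, P', ?_, ?_, ⟨g⟩⟩
    · rw [hP]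
      exact congrArg SetLike.coe (sepClosure_bot_eq_torsionSubmodule c h_one hM.tV.tσ)
    · rw [hP']
      exact congrArg SetLike.coe (sepClosure_bot_eq_torsionSubmodule c h_one hN.tV.tσ)
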